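/- Let $(R,\mathfrak m)$ be a one-dimensional Cohen-Macaulay local ring with a canonical ideal $I$ (an ideal $I\ne R$ isomorphic, as an $R$-module, to the canonical module of $R$), and assume that $I$ contains a parameter ideal $Q=(a)$ of $R$ as a reduction, i.e. $I^{n+1}=QI^n$ for some $n\ge 0$. Put $K=I/a=\{x/a \mid x\in I\}$ in the total ring of fractions $\mathrm Q(R)$, $S=R[K]\subseteq \mathrm Q(R)$ and $\mathfrak c=R:S$. A ring with such data is called *2-AGL* if the Sally module $\mathcal S_Q(I)=I\mathcal R/I\mathcal T$ (where $\mathcal R=R[It]$ and $\mathcal T=R[Qt]$) has rank $2$, that is, if $\ell_{\mathcal T_{\mathfrak p}}\big(\mathcal S_Q(I)_{\mathfrak p}\big)=2$ for $\mathfrak p=\mathfrak m\mathcal T$ (for some such choice of $I$ and $Q$). Let $A=R\ltimes\mathfrak c$ be the idealization of $\mathfrak c$ over $R$. **Theorem 4.2.** $A$ is again a one-dimensional Cohen-Macaulay local ring possessing a canonical ideal that contains a parameter ideal as a reduction, and $A$ is a 2-AGL ring if and only if $R$ is a 2-AGL ring. Consequently, suppose that $R$ is 2-AGL. Then there is a sequence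 of rings $A_0\cong R$, $A_{n}\cong A_{n-1}\ltimes\mathfrak c_{n-1}$ $(n\ge 1)$, where $\mathfrak c_{n-1}$ is the conductor of $A_{n-1}$ formed as above from a canonical ideal of $A_{n-1}$ and a parameter ideal that is a reduction of it; and for every such sequence, all the rings $A_n$ are 2-AGL, $A_n$ is analytically ramified (its completion is not reduced) for every $n\ge1$, and $A_m\not\cong A_n$ as rings whenever $m\neq n$. -/

import Mathlib

open Polynomial

universe u

/-- A Noetherian local ring of Krull dimension one and depth (at least, hence exactly) one, that is,
a one-dimensional Cohen-Macaulay local ring. -/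
structure IsCohenMacaulayDimOne (R : Type u) [CommRing R] [IsLocalRing R] : Prop where
  isNoetherianRing : IsNoetherianRing R
  ringKrullDim_eq_one : ringKrullDim R = 1
  exists_regular : ∃ x ∈ IsLocalRing.maximalIdeal R, x ∈ nonZeroDivisors R

/-- `M` is a canonical module of the one-dimensional Cohen-Macaulay local ring `R`: a maximal
Cohen-Macaulay module (finitely generated of depth one; it is nonzero by the type condition) of
finite injective dimension whose type, the length of `Ext¹(R/𝔪, M)`, is one. -/
structure IsCanonicalModule (R : Type u) [CommRing R] [IsLocalRing R]
    (M : Type u) [AddCommGroup M] [Module R M] : Prop where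
  finite : Module.Finite R M
  exists_regular : ∃ x ∈ IsLocalRing.maximalIdeal R, IsSMulRegular M x
  type_eq_one : Module.length R (CategoryTheory.Abelian.Ext
    (ModuleCat.of R (IsLocalRing.ResidueField R)) (ModuleCat.of R M) 1) = 1
  finite_injectiveDimension :
    ∃ n : ℕ, CategoryTheory.HasInjectiveDimensionLT (ModuleCat.of R M) n

/-- The standing data: a one-dimensional Cohen-Macaulay local ring `R`, a canonical ideal `I ≠ R`,
and an element `a` generating a parameter ideal `Q = (a)` which is a reduction of `I`. -/
structure CanonicalSetting (R : Type u) [CommRing R] [IsLocalRing R] where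
  isCohenMacaulay : IsCohenMacaulayDimOne R
  /-- the canonical ideal -/
  I : Ideal R
  I_ne_top : I ≠ ⊤
  isCanonical : IsCanonicalModule R I
  /-- the generator of the parameter ideal `Q` -/
  a : R
  isParameter : (Ideal.span {a}).radical = IsLocalRing.maximalIdeal R
  a_mem : a ∈ I
  isReduction : ∃ n : ℕ, I ^ (n + 1) = Ideal.span {a} * I ^ n

namespace CanonicalSetting

variable {R : Type u} [CommRing R] [IsLocalRing R] (D : CanonicalSetting R)

/-- The parameter ideal `Q = (a)`. -/
def Q : Ideal R := Ideal.span {D.a}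

/-- `K = I / a`, in the total ring of fractions of `R`. -/
def K : Submodule R (FractionRing R) where
  carrier := {y | ∃ x ∈ D.I,
    algebraMap R (FractionRing R) D.a * y = algebraMap R (FractionRing R) x}
  zero_mem' := ⟨0, D.I.zero_mem, by simp⟩
  add_mem' := by
    rintro y z ⟨x, hx, hy⟩ ⟨x', hx', hz⟩
    exact ⟨x + x', D.I.add_mem hx hx', by rw [mul_add, hy, hz, map_add]⟩
  smul_mem' := by
    rintro r y ⟨x, hx, hy⟩
    exact ⟨r * x, D.I.mul_mem_left r hx, by rw [mul_smul_comm, hy, Algebra.smul_def, map_mul]⟩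

/-- `S = R[K]`. -/
def S : Subalgebra R (FractionRing R) := Algebra.adjoin R (D.K : Set (FractionRing R))

/-- The conductor `𝔠 = R : S = {y | y S ⊆ R}`. As `1 ∈ S` it lies in `R`, and it is regarded as an
ideal of `R`. -/
def conductor : Ideal R :=
  ((1 : Submodule R (FractionRing R)) / Subalgebra.toSubmodule D.S).comap
    (Algebra.linearMap R (FractionRing R))

/-- The idealization `R ⋉ 𝔠`, with multiplication `(a, x)(b, y) = (ab, ay + bx)`. -/
abbrev Idealization : Type u := TrivSqZeroExt R D.conductor

/-- The Rees algebra `𝒯 = R[Qt]`, a subring of the polynomial ring `R[t]`. -/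
def T : Type u := reesAlgebra D.Q

noncomputable instance : CommRing D.T := inferInstanceAs (CommRing (reesAlgebra D.Q))

noncomputable instance : Algebra R D.T := inferInstanceAs (Algebra R (reesAlgebra D.Q))

/-- `R[t]` is a `𝒯`-algebra through the inclusion. -/
noncomputable instance : Algebra D.T R[X] := inferInstanceAs (Algebra (reesAlgebra D.Q) R[X])

/-- The product `I · R[Jt]`, as a `𝒯`-submodule of the polynomial ring `R[t]`
(used for `J = I` and `J = Q`; in these cases `R[Jt]` is closed under multiplication by `𝒯`). -/
noncomputable def mulRees (J : Ideal R) : Submodule D.T R[X] :=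
  D.I.map (algebraMap R D.T) • Submodule.span D.T (reesAlgebra J : Set R[X])

/-- The Sally module `I𝓡 / I𝒯`, where `𝓡 = R[It]` and `𝒯 = R[Qt]`, as a `𝒯`-module. -/
abbrev Sally : Type u := D.mulRees D.I ⧸ (D.mulRees D.Q).submoduleOf (D.mulRees D.I)

/-- The ideal `𝔭 = 𝔪𝒯`. -/
noncomputable def p : Ideal D.T := (IsLocalRing.maximalIdeal R).map (algebraMap R D.T)

theorem a_mem_nonZeroDivisors : D.a ∈ nonZeroDivisors R := by
  obtain ⟨x, hx, hreg⟩ := D.isCohenMacaulay.exists_regular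
  rw [← D.isParameter] at hx
  obtain ⟨n, hn⟩ := hx
  obtain ⟨r, hr⟩ := Ideal.mem_span_singleton'.mp hn
  have h := pow_mem hreg n
  rw [← hr] at h
  exact (mul_mem_nonZeroDivisors.mp h).2

/-- The map `R[X] → 𝒯`, `X ↦ at`. -/
noncomputable def toT : R[X] →ₐ[R] reesAlgebra D.Q :=
  aeval ⟨monomial 1 D.a, reesAlgebra.monomial_mem.mpr
    (by rw [pow_one]; exact Ideal.mem_span_singleton_self D.a)⟩

theorem coeff_toT (f : R[X]) (n : ℕ) : (D.toT f : R[X]).coeff n = D.a ^ n * f.coeff n := by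
  induction f using Polynomial.induction_on' with
  | add f g hf hg => simp [hf, hg, mul_add]
  | monomial m r =>
    simp only [toT, aeval_monomial, Subalgebra.coe_mul, Subalgebra.coe_pow,
      Subalgebra.coe_algebraMap, algebraMap_eq, monomial_pow, one_mul, C_mul_monomial,
      coeff_monomial]
    split_ifs with h
    · rw [h, mul_comm]
    · simp

theorem toT_bijective : Function.Bijective D.toT := by
  constructor
  · intro f g h
    ext n
    have h1 := congrArg (fun z : reesAlgebra D.Q => (z : R[X]).coeff n) h
    simp only [coeff_toT] at h1
    exact (mul_cancel_left_mem_nonZeroDivisors (pow_mem D.a_mem_nonZeroDivisors n)).mp h1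
  · intro g
    have hg : ∀ i, ∃ r, (g : R[X]).coeff i = D.a ^ i * r := by
      intro i
      have h1 := (mem_reesAlgebra_iff D.Q g).mp g.2 i
      change _ ∈ Ideal.span {D.a} ^ i at h1
      rw [Ideal.span_singleton_pow] at h1
      obtain ⟨r, hr⟩ := Ideal.mem_span_singleton'.mp h1
      exact ⟨r, by rw [← hr, mul_comm]⟩
    choose r hr using hg
    refine ⟨∑ i ∈ (g : R[X]).support, monomial i (r i), ?_⟩
    apply Subtype.ext
    ext n
    rw [coeff_toT]
    simp only [finsetSum_coeff, coeff_monomial, Finset.sum_ite_eq', mem_support_iff]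
    split_ifs with h
    · rw [hr]
    · rw [mul_zero]
      exact (notMem_support_iff.mp h).symm

theorem p_isPrime_aux : ((IsLocalRing.maximalIdeal R).map
    (algebraMap R (reesAlgebra D.Q))).IsPrime := by
  let e : R[X] ≃ₐ[R] reesAlgebra D.Q := AlgEquiv.ofBijective D.toT D.toT_bijective
  have h : (IsLocalRing.maximalIdeal R).map (algebraMap R (reesAlgebra D.Q)) =
      ((IsLocalRing.maximalIdeal R).map (C : R →+* R[X])).map (e.toRingEquiv : R[X] →+* _) := by
    rw [Ideal.map_map]
    congr 1
    ext1 r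
    exact (e.commutes r).symm
  rw [h]
  exact Ideal.map_isPrime_of_equiv e.toRingEquiv

instance p_isPrime : D.p.IsPrime := D.p_isPrime_aux

/-- The rank of the Sally module: the length over `𝒯_𝔭` of its localization at `𝔭 = 𝔪𝒯`. -/
noncomputable def sallyRank : ℕ∞ :=
  Module.length (Localization.AtPrime D.p) (LocalizedModule D.p.primeCompl D.Sally)

end CanonicalSetting

/-- `R` is a 2-almost Gorenstein local (2-AGL) ring: it is a one-dimensional Cohen-Macaulay local
ring having a canonical ideal `I` with a parameter ideal `Q` as a reduction, and the Sally module of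
`I` with respect to `Q` has rank two. -/
def IsTwoAGL (R : Type u) [CommRing R] [IsLocalRing R] : Prop :=
  ∃ D : CanonicalSetting R, D.sallyRank = 2

/-- The completion of `R` at its maximal ideal is not reduced. -/
def IsAnalyticallyRamified (R : Type u) [CommRing R] [IsLocalRing R] : Prop :=
  ¬ IsReduced (AdicCompletion (IsLocalRing.maximalIdeal R) R)

/-- The idealization of a module over a local ring is local. -/
instance isLocalRing_trivSqZeroExt {R M : Type u} [CommRing R] [IsLocalRing R] [AddCommGroup M]
    [Module R M] [Module Rᵐᵒᵖ M] [IsCentralScalar R M] : IsLocalRing (TrivSqZeroExt R M) :=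
  have : Nontrivial (TrivSqZeroExt R M) :=
    ⟨⟨0, 1, fun h => zero_ne_one (α := R) (congrArg TrivSqZeroExt.fst h)⟩⟩
  IsLocalRing.of_isUnit_or_isUnit_of_isUnit_add (fun a b h => by
    simp only [TrivSqZeroExt.isUnit_iff_isUnit_fst]
    exact IsLocalRing.isUnit_or_isUnit_of_isUnit_add
      (by simpa using TrivSqZeroExt.isUnit_iff_isUnit_fst.mp h))

/-- `A 0, A 1, A 2, …` is obtained from `R` by iterated idealization of conductors: `A 0` is `R`,
and `A (n + 1)` is the idealization `A n ⋉ 𝔠ₙ` of the conductor of `A n`. -/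
def IsConductorTower (R : Type u) [CommRing R] (A : ℕ → Type u) [∀ n, CommRing (A n)]
    [∀ n, IsLocalRing (A n)] : Prop :=
  Nonempty (A 0 ≃+* R) ∧
    ∀ n, ∃ D : CanonicalSetting (A n), Nonempty (A (n + 1) ≃+* D.Idealization)

/-! Choose `n` with `I ^ (n + 1) = a I ^ n`. Then `S = I ^ n / a ^ n`, and inside the total ring of
fractions `K : K = R` and `K : 𝔠 = S`. The canonical module of `A = R ⋉ 𝔠` is `Hom_R(A, K) = (K : 𝔠)
× K = S × K =: L`. Since `S K = S`, one gets `L² = S × S = L³`. Multiplied by `a ^ (n + 1)`, `L`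
becomes the ideal `I ^ (n + 1) × a ^ n I` of `A`, which has `a ^ (n + 1)` as a reduction.

The rank of a Sally module is the length of `S / K`. Up to an inclusion whose cokernel dies in the
localization at `𝔭`, the Sally module is the base change to `𝒯` of the single graded piece `I ^ (n +
1) / a ^ n I`, for large `n`. The map `R → 𝒯_𝔭` is flat and local with a field as closed fibre, so
lengths are preserved (`sallyRank_eq_length`). For `A` this length is that of `(S × S) / (S × K)`,
which is again that of `S / K` (`sallyRank_idealization`). Canonical ideals are unique up to a
factor from the total ring of fractions, so the rank does not depend on the datum (`sallyRank_eq`),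
and one datum decides whether a ring is 2-AGL.

The `Ext` definition of a canonical module is first traded for two statements on homomorphisms:
extension of maps from submodules with torsion-free quotient, and type one. Both pass from `M` to
`Hom_R(A, M)`, and together they give the duality `I : (I : F) = F` on regular ideals, from which
the two colon formulas and uniqueness follow.

For the tower, `𝔠` contains the regular element `a ^ n`. So `A` has nonzero elements of square zero,
and these survive in the completion. By Nakayama the embedding dimension grows strictly at each
step, so no two members are isomorphic. -/

theorem isFiniteLength_of_smul_eq_zero {R : Type u} [CommRing R] [IsNoetherianRing R] {x : R}
    [IsArtinianRing (R ⧸ Ideal.span {x})] {N : Type u} [AddCommGroup N] [Module R N]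
    [Module.Finite R N] (hN : ∀ y : N, x • y = 0) : IsFiniteLength R N := by
  rw [isFiniteLength_iff_isNoetherian_isArtinian]
  refine ⟨inferInstance, ?_⟩
  have ht : Module.IsTorsionBySet R N (Ideal.span {x} : Ideal R) := by
    rw [Module.isTorsionBySet_span_singleton_iff]
    exact hN
  let := ht.module
  have : IsScalarTower R (R ⧸ Ideal.span {x}) N := ht.isScalarTower
  have : Module.Finite (R ⧸ Ideal.span {x}) N := Module.Finite.of_restrictScalars_finite R _ N
  exact isArtinian_of_surjective_algebraMap (R := R ⧸ Ideal.span {x})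
    (Ideal.Quotient.mk_surjective (I := Ideal.span {x}))

/-! ### Artinian quotients of one-dimensional Cohen-Macaulay rings. -/

section CohenMacaulay

variable {R : Type u} [CommRing R] [IsLocalRing R]

theorem IsCohenMacaulayDimOne.isArtinianRing_quotient (h : IsCohenMacaulayDimOne R) {x : R}
    (hx : x ∈ IsLocalRing.maximalIdeal R) (hreg : x ∈ nonZeroDivisors R) :
    IsArtinianRing (R ⧸ Ideal.span {x}) := by
  have := h.isNoetherianRing
  have h1 := ringKrullDim_quotient_span_singleton_succ_eq_ringKrullDim_of_mem_nonZeroDivisors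
    hreg hx
  rw [h.ringKrullDim_eq_one] at h1
  rw [isArtinianRing_iff_krullDimLE_zero, Ring.krullDimLE_iff]
  generalize ringKrullDim (R ⧸ Ideal.span {x}) = d at h1
  induction d with
  | bot => simp
  | coe d =>
    induction d with
    | top => exact absurd h1 (by decide)
    | coe d =>
      norm_cast at h1 ⊢
      omega

end CohenMacaulay

/-! ### Vanishing of `Ext` along short exact sequences. -/

section ExtVanishing

open CategoryTheory Abelian IsLocalRing

variable {R : Type u} [CommRing R] {A B C M : Type u} [AddCommGroup A] [Module R A]
  [AddCommGroup B] [Module R B] [AddCommGroup C] [Module R C] [AddCommGroup M] [Module R M]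

/-- `Ext` of modules, without the passage to the category of modules. -/
abbrev ModExt (R : Type u) [CommRing R] (N M : Type u) [AddCommGroup N] [Module R N]
    [AddCommGroup M] [Module R M] (r : ℕ) : Type u :=
  Ext (ModuleCat.of R N) (ModuleCat.of R M) r

/-- The short complex of a short exact sequence of modules. -/
abbrev modShortComplex (f : A →ₗ[R] B) (g : B →ₗ[R] C) (h : Function.Exact f g) :
    ShortComplex (ModuleCat.{u} R) :=
  ModuleCat.shortComplexOfCompEqZero f g h.linearMap_comp_eq_zero

theorem modShortComplex_shortExact {f : A →ₗ[R] B} {g : B →ₗ[R] C} (h : Function.Exact f g)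
    (hf : Function.Injective f) (hg : Function.Surjective g) :
    (modShortComplex f g h).ShortExact :=
  ModuleCat.shortComplex_shortExact _ h hf hg

variable {f : A →ₗ[R] B} {g : B →ₗ[R] C} (h : Function.Exact f g)
    (hf : Function.Injective f) (hg : Function.Surjective g)
include h hf hg

theorem subsingleton_ext_middle (r : ℕ) [Subsingleton (ModExt R A M r)]
    [Subsingleton (ModExt R C M r)] : Subsingleton (ModExt R B M r) := by
  refine subsingleton_of_forall_eq 0 fun x => ?_
  obtain ⟨y, rfl⟩ := Ext.contravariant_sequence_exact₂ (modShortComplex_shortExact h hf hg) _ x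
    (Subsingleton.elim (α := ModExt R A M r) _ _)
  rw [Subsingleton.elim (α := ModExt R C M r) y 0, Ext.comp_zero]

theorem subsingleton_ext_left (r : ℕ) [Subsingleton (ModExt R B M r)]
    [Subsingleton (ModExt R C M (r + 1))] : Subsingleton (ModExt R A M r) := by
  refine subsingleton_of_forall_eq 0 fun x => ?_
  obtain ⟨y, rfl⟩ := Ext.contravariant_sequence_exact₁ (modShortComplex_shortExact h hf hg) _ x
    (n₁ := r + 1) (add_comm _ _) (Subsingleton.elim (α := ModExt R C M (r + 1)) _ _)
  rw [Subsingleton.elim (α := ModExt R B M r) y 0, Ext.comp_zero]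

theorem subsingleton_ext_right (r : ℕ) [Subsingleton (ModExt R A M r)]
    [Subsingleton (ModExt R B M (r + 1))] : Subsingleton (ModExt R C M (r + 1)) := by
  refine subsingleton_of_forall_eq 0 fun x => ?_
  obtain ⟨y, rfl⟩ := Ext.contravariant_sequence_exact₃ (modShortComplex_shortExact h hf hg) _ x
    (Subsingleton.elim (α := ModExt R B M (r + 1)) _ _) (n₀ := r) (add_comm _ _)
  rw [Subsingleton.elim (α := ModExt R A M r) y 0, Ext.comp_zero]

omit h hf hg in
theorem subsingleton_ext_of_linearEquiv (e : A ≃ₗ[R] B) (r : ℕ) [Subsingleton (ModExt R A M r)] :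
    Subsingleton (ModExt R B M r) := by
  refine subsingleton_of_forall_eq 0 fun x => ?_
  have hz : (Ext.mk₀ (ModuleCat.ofHom e.toLinearMap)).comp x (zero_add r) = 0 :=
    Subsingleton.elim (α := ModExt R A M r) _ _
  have h2 : (Ext.mk₀ (ModuleCat.ofHom e.symm.toLinearMap)).comp
      ((Ext.mk₀ (ModuleCat.ofHom e.toLinearMap)).comp x (zero_add r)) (zero_add r) = x := by
    rw [← Ext.comp_assoc_of_second_deg_zero, Ext.mk₀_comp_mk₀]
    have : ModuleCat.ofHom e.symm.toLinearMap ≫ ModuleCat.ofHom e.toLinearMap = 𝟙 _ := by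
      ext y; simp
    rw [this, Ext.mk₀_id_comp]
  rw [← h2, hz, Ext.comp_zero]

omit h hf hg in
/-- Nakayama's lemma for `Ext`. -/
theorem subsingleton_ext_of_smul [IsLocalRing R] [IsNoetherianRing R] [Module.Finite R A]
    [Module.Finite R M] {x : R} (hx : x ∈ maximalIdeal R) (hreg : IsSMulRegular A x) (r : ℕ)
    [Subsingleton (ModExt R (A ⧸ LinearMap.range (LinearMap.lsmul R A x)) M (r + 1))] :
    Subsingleton (ModExt R A M r) := by
  have hex : Function.Exact (LinearMap.lsmul R A x)
      (LinearMap.range (LinearMap.lsmul R A x)).mkQ := by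
    rw [LinearMap.exact_iff, Submodule.ker_mkQ]
  have key : ∀ y : ModExt R A M r, ∃ z : ModExt R A M r, x • z = y := by
    intro y
    obtain ⟨z, hz⟩ := Ext.contravariant_sequence_exact₁
      (modShortComplex_shortExact hex hreg (Submodule.mkQ_surjective _)) _ y
      (n₁ := r + 1) (add_comm _ _) (Subsingleton.elim (α := ModExt R (A ⧸ _) M (r + 1)) _ _)
    refine ⟨z, ?_⟩
    rw [← hz]
    have : (modShortComplex (LinearMap.lsmul R A x) _ hex).f = x • 𝟙 (ModuleCat.of R A) := by
      ext; simp
    rw [this, Ext.mk₀_smul, Ext.smul_comp, Ext.mk₀_id_comp]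
  have htop : (⊤ : Submodule R (ModExt R A M r)) ≤ maximalIdeal R • ⊤ := by
    intro y _
    obtain ⟨z, rfl⟩ := key y
    exact Submodule.smul_mem_smul hx trivial
  have := Submodule.eq_bot_of_le_smul_of_le_jacobson_bot (maximalIdeal R) ⊤
    (Module.Finite.fg_top (R := R) (M := ModExt R A M r)) htop (maximalIdeal_le_jacobson _)
  exact (Submodule.subsingleton_iff R).mp (subsingleton_of_bot_eq_top this.symm)

end ExtVanishing

/-! ### Bass' theorem: finite injective dimension is at most one. -/

section ExtVanishing

open CategoryTheory Abelian IsLocalRing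

theorem subsingleton_ext_of_free {R M : Type u} [CommRing R]
    [AddCommGroup M] [Module R M] {N : Type u} [AddCommGroup N] [Module R N] [Module.Free R N] (r : ℕ) :
    Subsingleton (ModExt R N M (r + 1)) :=
  Ext.subsingleton_of_projective _ _ _

variable {R : Type u} [CommRing R] [IsLocalRing R]

theorem nonempty_linearEquiv_residueField (S : Type u) [AddCommGroup S] [Module R S]
    [IsSimpleModule R S] : Nonempty (S ≃ₗ[R] ResidueField R) := by
  obtain ⟨I, hI, ⟨e⟩⟩ := isSimpleModule_iff_quot_maximal.mp ‹IsSimpleModule R S›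
  obtain rfl := eq_maximalIdeal hI
  exact ⟨e⟩

variable {M : Type u} [AddCommGroup M] [Module R M]

theorem subsingleton_ext_of_isFiniteLength {r : ℕ}
    (hk : Subsingleton (ModExt R (ResidueField R) M r)) {N : Type u} [AddCommGroup N] [Module R N]
    (hN : IsFiniteLength R N) : Subsingleton (ModExt R N M r) := by
  induction hN with
  | of_subsingleton =>
    rename_i N _ _ _
    refine subsingleton_of_forall_eq 0 fun x => ?_
    have : 𝟙 (ModuleCat.of R N) = 0 := by
      ext y
      exact Subsingleton.elim (α := N) _ _
    rw [← Ext.mk₀_id_comp x, this, Ext.mk₀_zero, Ext.zero_comp]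
  | of_simple_quotient hN ih =>
    rename_i N _ _ N' _
    obtain ⟨e⟩ := nonempty_linearEquiv_residueField (R := R) (N ⧸ N')
    have := subsingleton_ext_of_linearEquiv (M := M) e.symm r
    exact subsingleton_ext_middle (f := N'.subtype) (g := N'.mkQ)
      (LinearMap.exact_subtype_mkQ N') N'.subtype_injective N'.mkQ_surjective r

/-- One step of Bass' theorem that the injective dimension is at most the depth. -/
theorem subsingleton_ext_step (h : IsCohenMacaulayDimOne R) [Module.Finite R M] {x : R}
    (hx : x ∈ maximalIdeal R) (hreg : x ∈ nonZeroDivisors R) (r : ℕ)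
    (hr : ∀ (N : Type u) [AddCommGroup N] [Module R N] [Module.Finite R N],
      Subsingleton (ModExt R N M (r + 3)))
    (N : Type u) [AddCommGroup N] [Module R N] [Module.Finite R N] :
    Subsingleton (ModExt R N M (r + 2)) := by
  have := h.isNoetherianRing
  have := h.isArtinianRing_quotient hx hreg
  have hxR : IsSMulRegular R x := Module.Flat.isSMulRegular_of_nonZeroDivisors hreg
  let X := R ⧸ LinearMap.range (LinearMap.lsmul R R x)
  have hX : Subsingleton (ModExt R X M (r + 2)) := by
    have h1 : Subsingleton (ModExt R R M (r + 1)) := subsingleton_ext_of_free _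
    have h2 : Subsingleton (ModExt R R M (r + 1 + 1)) := subsingleton_ext_of_free _
    exact subsingleton_ext_right (f := LinearMap.lsmul R R x) (g := Submodule.mkQ _)
      (by rw [LinearMap.exact_iff, Submodule.ker_mkQ]) hxR (Submodule.mkQ_surjective _) (r + 1)
  have hfin : ∀ (N : Type u) [AddCommGroup N] [Module R N],
      ∀ y : N ⧸ LinearMap.range (LinearMap.lsmul R N x), x • y = 0 := by
    intro N _ _ y
    obtain ⟨y, rfl⟩ := Submodule.mkQ_surjective _ y
    rw [← map_smul]
    exact (Submodule.Quotient.mk_eq_zero _).mpr ⟨y, rfl⟩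
  have hXlen : IsFiniteLength R X := isFiniteLength_of_smul_eq_zero (hfin R)
  have := (isFiniteLength_iff_isNoetherian_isArtinian.mp hXlen).2
  have : Nontrivial X := by
    refine Submodule.Quotient.nontrivial_iff.mpr fun htop => ?_
    obtain ⟨y, hy⟩ := htop.ge (Submodule.mem_top (x := (1 : R)))
    exact (mem_maximalIdeal x).mp hx (IsUnit.of_mul_eq_one y hy)
  -- The residue field embeds in the socle of `X = R / x`. As degree `r + 3` vanishes, restriction
  -- from `X` is onto in degree `r + 2`, where `X` contributes nothing because its projective
  -- dimension is at most one.
  have hk : Subsingleton (ModExt R (ResidueField R) M (r + 2)) := by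
    obtain ⟨S, hS⟩ := IsAtomic.exists_atom (Submodule R X)
    have : IsSimpleModule R S := isSimpleModule_iff_isAtom.mpr hS
    obtain ⟨e⟩ := nonempty_linearEquiv_residueField (R := R) S
    have h3 : Subsingleton (ModExt R (X ⧸ S) M (r + 2 + 1)) := hr _
    have : Subsingleton (ModExt R S M (r + 2)) :=
      subsingleton_ext_left (f := S.subtype) (g := S.mkQ)
        (LinearMap.exact_subtype_mkQ S) S.subtype_injective S.mkQ_surjective (r + 2)
    exact subsingleton_ext_of_linearEquiv e (r + 2)
  -- The first syzygy of `N` is `x`-regular even when `N` is not. Its reduction modulo `x` has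
  -- finite length, so Nakayama kills its `Ext` in degree `r + 1`, and dimension shifting returns to
  -- `N`.
  obtain ⟨n, f, hf⟩ := Module.Finite.exists_fin' R N
  have hker : IsSMulRegular (LinearMap.ker f) x := by
    intro a b hab
    ext i
    exact hxR (congrFun (congrArg Subtype.val hab) i)
  have h4 : Subsingleton (ModExt R (LinearMap.ker f) M (r + 1)) := by
    have := subsingleton_ext_of_isFiniteLength hk (isFiniteLength_of_smul_eq_zero
      (hfin (LinearMap.ker f)))
    exact subsingleton_ext_of_smul hx hker (r + 1)
  have h5 : Subsingleton (ModExt R (Fin n → R) M (r + 1 + 1)) := subsingleton_ext_of_free _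
  exact subsingleton_ext_right (f := (LinearMap.ker f).subtype) (g := f)
    (LinearMap.exact_subtype_ker_map f) (Submodule.subtype_injective _) hf (r + 1)

theorem subsingleton_ext_two (h : IsCohenMacaulayDimOne R) [Module.Finite R M] (n : ℕ)
    (hn : HasInjectiveDimensionLT (ModuleCat.of R M) n)
    (N : Type u) [AddCommGroup N] [Module R N] [Module.Finite R N] :
    Subsingleton (ModExt R N M 2) := by
  obtain ⟨x, hx, hreg⟩ := h.exists_regular
  suffices ∀ r : ℕ, (∀ (N : Type u) [AddCommGroup N] [Module R N] [Module.Finite R N],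
      Subsingleton (ModExt R N M (r + 2))) → ∀ (N : Type u) [AddCommGroup N] [Module R N]
      [Module.Finite R N], Subsingleton (ModExt R N M 2) from
    this n (fun N _ _ _ => HasInjectiveDimensionLT.subsingleton _ n _ (by omega) _) N
  intro r
  induction r with
  | zero => exact fun h => h
  | succ r ih => exact fun hr => ih fun N _ _ _ => subsingleton_ext_step h hx hreg r hr N

/-- A finitely generated module of finite injective dimension has no extensions by finitely
generated torsion-free modules. -/
theorem subsingleton_ext_one (h : IsCohenMacaulayDimOne R) [Module.Finite R M] (n : ℕ)
    (hn : HasInjectiveDimensionLT (ModuleCat.of R M) n) {x : R} (hx : x ∈ maximalIdeal R)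
    (N : Type u) [AddCommGroup N] [Module R N] [Module.Finite R N] (hN : IsSMulRegular N x) :
    Subsingleton (ModExt R N M 1) := by
  have := h.isNoetherianRing
  have := subsingleton_ext_two h n hn (N ⧸ LinearMap.range (LinearMap.lsmul R N x))
  exact subsingleton_ext_of_smul hx hN 1

end ExtVanishing

/-! ### Elementary characterization of canonical modules. -/

section

open CategoryTheory Abelian IsLocalRing

/-- Every homomorphism to `M` from a submodule `N` of a finite free module with `x`-torsion-free
quotient extends: an elementary form of the vanishing of `Ext¹` on torsion-free modules. -/
def HasTorsionFreeExtension {R : Type u} [CommRing R] (x : R) (M : Type u) [AddCommGroup M]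
    [Module R M] : Prop :=
  ∀ (n : ℕ) (N : Submodule R (Fin n → R)), (∀ v, x • v ∈ N → v ∈ N) →
    ∀ g : N →ₗ[R] M, ∃ h : (Fin n → R) →ₗ[R] M, ∀ y : N, h y = g y

/-- The homomorphisms `𝔪 → M` form, modulo those given by elements of `M`, a one-dimensional vector
space over the residue field: an elementary form of the type being one. -/
def HasTypeOne (R : Type u) [CommRing R] [IsLocalRing R] (M : Type u) [AddCommGroup M]
    [Module R M] : Prop :=
  ∃ h₀ : maximalIdeal R →ₗ[R] M, (¬ ∃ z : M, ∀ y, h₀ y = (y : R) • z) ∧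
    ∀ h : maximalIdeal R →ₗ[R] M, ∃ (r : R) (z : M), ∀ y, h y = r • h₀ y + (y : R) • z

theorem exists_extension_of_subsingleton_ext {R A B C M : Type u} [CommRing R] [AddCommGroup A]
    [Module R A] [AddCommGroup B] [Module R B] [AddCommGroup C] [Module R C] [AddCommGroup M]
    [Module R M] {f : A →ₗ[R] B} {g : B →ₗ[R] C} (h : Function.Exact f g)
    (hf : Function.Injective f) (hg : Function.Surjective g) [Subsingleton (ModExt R C M 1)]
    (φ : A →ₗ[R] M) : ∃ ψ : B →ₗ[R] M, ψ ∘ₗ f = φ := by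
  obtain ⟨y, hy⟩ := Ext.contravariant_sequence_exact₁ (modShortComplex_shortExact h hf hg) _
    (Ext.mk₀ (ModuleCat.ofHom φ)) (n₁ := 1) (add_comm _ _)
    (Subsingleton.elim (α := ModExt R C M 1) _ _)
  obtain ⟨ψ, rfl⟩ := (Ext.mk₀_bijective _ _).2 y
  rw [Ext.mk₀_comp_mk₀] at hy
  exact ⟨ψ.hom, congrArg ModuleCat.Hom.hom ((Ext.mk₀_bijective _ _).1 hy)⟩

variable {R : Type u} [CommRing R] [IsLocalRing R] {M : Type u} [AddCommGroup M] [Module R M]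

theorem hasTorsionFreeExtension_of_hasInjectiveDimensionLT (h : IsCohenMacaulayDimOne R)
    [Module.Finite R M] {n : ℕ} (hn : HasInjectiveDimensionLT (ModuleCat.of R M) n) {x : R}
    (hx : x ∈ maximalIdeal R) : HasTorsionFreeExtension x M := by
  intro m N hN g
  have hreg : IsSMulRegular ((Fin m → R) ⧸ N) x := by
    rw [isSMulRegular_iff_right_eq_zero_of_smul]
    intro y hy
    obtain ⟨y, rfl⟩ := N.mkQ_surjective y
    rw [← map_smul] at hy
    exact (Submodule.Quotient.mk_eq_zero N).mpr (hN y ((Submodule.Quotient.mk_eq_zero N).mp hy))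
  have := subsingleton_ext_one h n hn hx _ hreg
  obtain ⟨ψ, hψ⟩ := exists_extension_of_subsingleton_ext (LinearMap.exact_subtype_mkQ N)
    N.subtype_injective N.mkQ_surjective g
  exact ⟨ψ, fun y => LinearMap.congr_fun hψ y⟩

theorem exact_maximalIdeal_residueField :
    Function.Exact (maximalIdeal R).subtype (Algebra.linearMap R (ResidueField R)) := by
  rw [LinearMap.exact_iff, Submodule.range_subtype]
  ext y
  exact residue_eq_zero_iff y

variable (R M) in
/-- The connecting homomorphism `Hom(𝔪, M) → Ext¹(R/𝔪, M)`. -/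
noncomputable def residueConnecting :
    (maximalIdeal R →ₗ[R] M) →ₗ[R] ModExt R (ResidueField R) M 1 where
  toFun h := (modShortComplex_shortExact (exact_maximalIdeal_residueField (R := R))
    (Submodule.subtype_injective _) residue_surjective).extClass.comp
      (Ext.mk₀ (ModuleCat.ofHom h)) (add_comm 1 0)
  map_add' h h' := by rw [ModuleCat.ofHom_add, Ext.mk₀_add, Ext.comp_add]
  map_smul' r h := by
    have : ModuleCat.ofHom (r • h) = r • ModuleCat.ofHom h := rfl
    rw [this, Ext.mk₀_smul, Ext.comp_smul, RingHom.id_apply]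

theorem residueConnecting_surjective : Function.Surjective (residueConnecting R M) := by
  have := subsingleton_ext_of_free (R := R) (M := M) (N := R) 0
  intro y
  obtain ⟨z, hz⟩ := Ext.contravariant_sequence_exact₃
    (modShortComplex_shortExact (exact_maximalIdeal_residueField (R := R))
    (Submodule.subtype_injective _) residue_surjective) _ y
    (Subsingleton.elim (α := ModExt R R M 1) _ _) (n₀ := 0) (add_comm _ _)
  obtain ⟨ψ, rfl⟩ := (Ext.mk₀_bijective _ _).2 z
  exact ⟨ψ.hom, hz⟩

theorem residueConnecting_eq_zero_iff (h : maximalIdeal R →ₗ[R] M) :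
    residueConnecting R M h = 0 ↔ ∃ z : M, ∀ y, h y = (y : R) • z := by
  have hS := modShortComplex_shortExact (exact_maximalIdeal_residueField (R := R))
    (Submodule.subtype_injective _) residue_surjective
  constructor
  · intro h0
    obtain ⟨y, hy⟩ := Ext.contravariant_sequence_exact₁ hS _
      (Ext.mk₀ (ModuleCat.ofHom h)) (n₁ := 1) (add_comm _ _) h0
    obtain ⟨ψ, rfl⟩ := (Ext.mk₀_bijective _ _).2 y
    rw [Ext.mk₀_comp_mk₀] at hy
    have h1 := congrArg ModuleCat.Hom.hom ((Ext.mk₀_bijective _ _).1 hy)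
    refine ⟨ψ.hom (1 : R), fun y => ?_⟩
    have h2 := LinearMap.congr_fun h1 y
    rw [← map_smul, smul_eq_mul, mul_one]
    exact h2.symm
  · rintro ⟨z, hz⟩
    have : h = (LinearMap.toSpanSingleton R M z) ∘ₗ (maximalIdeal R).subtype := by
      ext y
      simp [hz]
    change hS.extClass.comp (Ext.mk₀ (ModuleCat.ofHom h)) (add_comm 1 0) = 0
    rw [this, ModuleCat.ofHom_comp, ← Ext.mk₀_comp_mk₀]
    exact hS.extClass_comp_assoc _

theorem length_ext_residueField_eq_one_iff :
    Module.length R (ModExt R (ResidueField R) M 1) = 1 ↔ HasTypeOne R M := by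
  rw [Module.length_eq_one_iff, isSimpleModule_iff_toSpanSingleton_surjective]
  constructor
  · rintro ⟨hnt, hs⟩
    obtain ⟨e, he⟩ := exists_ne (0 : ModExt R (ResidueField R) M 1)
    obtain ⟨h₀, rfl⟩ := residueConnecting_surjective e
    refine ⟨h₀, fun h => he ((residueConnecting_eq_zero_iff h₀).mpr h), fun h => ?_⟩
    obtain ⟨r, hr⟩ := hs _ he (residueConnecting R M h)
    rw [LinearMap.toSpanSingleton_apply, ← map_smul, eq_comm, ← sub_eq_zero, ← map_sub,
      residueConnecting_eq_zero_iff] at hr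
    obtain ⟨z, hz⟩ := hr
    refine ⟨r, z, fun y => ?_⟩
    rw [← hz, LinearMap.sub_apply, LinearMap.smul_apply]
    abel
  · rintro ⟨h₀, h0, h1⟩
    have he : residueConnecting R M h₀ ≠ 0 := fun h => h0 ((residueConnecting_eq_zero_iff h₀).mp h)
    have hgen : ∀ e, ∃ r : R, r • residueConnecting R M h₀ = e := by
      intro e
      obtain ⟨h, rfl⟩ := residueConnecting_surjective e
      obtain ⟨r, z, hz⟩ := h1 h
      refine ⟨r, ?_⟩
      rw [← map_smul, eq_comm, ← sub_eq_zero, ← map_sub, residueConnecting_eq_zero_iff]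
      exact ⟨z, fun y => by rw [LinearMap.sub_apply, hz, LinearMap.smul_apply]; abel⟩
    refine ⟨⟨_, _, he⟩, fun e hne e' => ?_⟩
    obtain ⟨r, rfl⟩ := hgen e
    obtain ⟨r', rfl⟩ := hgen e'
    -- For `r` in the maximal ideal, `r • h₀` is `y ↦ y • h₀ r`, which comes from an element of `M`
    -- and dies in `Ext`. So every nonzero multiple of the generator is a unit multiple.
    have hr : IsUnit r := by
      by_contra hr
      refine hne ?_
      rw [← map_smul, residueConnecting_eq_zero_iff]
      refine ⟨h₀ ⟨r, (mem_maximalIdeal r).mpr hr⟩, fun y => ?_⟩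
      rw [LinearMap.smul_apply, ← map_smul, ← map_smul]
      congr 1
      ext
      exact mul_comm _ _
    obtain ⟨v, rfl⟩ := hr
    refine ⟨r' * (v⁻¹ : Rˣ), ?_⟩
    rw [LinearMap.toSpanSingleton_apply, smul_smul, mul_assoc, Units.inv_mul, mul_one]

end

section

open CategoryTheory Abelian IsLocalRing

variable {R : Type u} [CommRing R] {M : Type u} [AddCommGroup M] [Module R M] {x : R}

/-- Pulling `N` back along a surjection from a finite free module keeps the quotient torsion-free.
The extension found there vanishes on the kernel, because the pulled-back map does, and so descends
to `F`. -/
theorem HasTorsionFreeExtension.exists_extension (h : HasTorsionFreeExtension x M) {F : Type u}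
    [AddCommGroup F] [Module R F] [Module.Finite R F] (N : Submodule R F)
    (hN : ∀ v, x • v ∈ N → v ∈ N) (g : N →ₗ[R] M) :
    ∃ h : F →ₗ[R] M, ∀ y : N, h y = g y := by
  obtain ⟨n, f, hf⟩ := Module.Finite.exists_fin' R F
  obtain ⟨ψ, hψ⟩ := h n (N.comap f) (fun v hv => hN _ (by rwa [Submodule.mem_comap, map_smul] at hv))
    (g ∘ₗ (f.restrict (p := N.comap f) (q := N) fun y hy => hy))
  have hker : LinearMap.ker f ≤ LinearMap.ker ψ := by
    intro y hy
    have hy' : y ∈ N.comap f := by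
      rw [Submodule.mem_comap, LinearMap.mem_ker.mp hy]
      exact N.zero_mem
    have h1 := hψ ⟨y, hy'⟩
    rw [LinearMap.mem_ker, h1, LinearMap.comp_apply]
    have : f.restrict (p := N.comap f) (q := N) (fun y hy => hy) ⟨y, hy'⟩ = 0 := by
      ext
      exact LinearMap.mem_ker.mp hy
    rw [this, map_zero]
  refine ⟨(LinearMap.ker f).liftQ ψ hker ∘ₗ (f.quotKerEquivOfSurjective hf).symm.toLinearMap,
    fun y => ?_⟩
  obtain ⟨v, hv⟩ := hf y
  have h2 : (f.quotKerEquivOfSurjective hf).symm (y : F) = Submodule.Quotient.mk v := by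
    rw [LinearEquiv.symm_apply_eq, ← hv]
    rfl
  have hv' : v ∈ N.comap f := by
    rw [Submodule.mem_comap, hv]
    exact y.2
  have h3 := hψ ⟨v, hv'⟩
  rw [LinearMap.comp_apply, LinearEquiv.coe_coe, h2, Submodule.liftQ_apply]
  refine h3.trans (congrArg g ?_)
  ext
  exact hv

theorem HasTorsionFreeExtension.of_linearEquiv {M' : Type u} [AddCommGroup M'] [Module R M']
    (e : M ≃ₗ[R] M') (h : HasTorsionFreeExtension x M) : HasTorsionFreeExtension x M' := by
  intro n N hN g
  obtain ⟨ψ, hψ⟩ := h n N hN (e.symm.toLinearMap ∘ₗ g)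
  exact ⟨e.toLinearMap ∘ₗ ψ, fun y => by simp [hψ]⟩

theorem HasTypeOne.of_linearEquiv [IsLocalRing R] {M' : Type u} [AddCommGroup M'] [Module R M']
    (e : M ≃ₗ[R] M') (h : HasTypeOne R M) : HasTypeOne R M' := by
  obtain ⟨h₀, h1, h2⟩ := h
  refine ⟨e.toLinearMap ∘ₗ h₀, fun ⟨z, hz⟩ => h1 ⟨e.symm z, fun y => ?_⟩, fun f => ?_⟩
  · rw [← map_smul, LinearEquiv.eq_symm_apply, ← hz]
    rfl
  · obtain ⟨r, z, hz⟩ := h2 (e.symm.toLinearMap ∘ₗ f)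
    refine ⟨r, e z, fun y => ?_⟩
    have := congrArg e (hz y)
    simpa using this

/-- Modules with the torsion-free extension property have injective dimension at most one. -/
theorem HasTorsionFreeExtension.hasInjectiveDimensionLT_two [IsNoetherianRing R]
    (h : HasTorsionFreeExtension x M) (hx : x ∈ nonZeroDivisors R) :
    HasInjectiveDimensionLT (ModuleCat.of R M) 2 := by
  let E := Injective.under (ModuleCat.of R M)
  let i : M →ₗ[R] E := (Injective.ι (ModuleCat.of R M)).hom
  have hi : Function.Injective i :=
    (ModuleCat.mono_iff_injective (Injective.ι (ModuleCat.of R M))).mp inferInstance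
  have hE : Module.Injective R E :=
    Module.injective_module_of_injective_object R E (inj := inferInstanceAs (Injective E))
  let C := E ⧸ LinearMap.range i
  -- Baer's criterion for the cokernel of `M → E`. Lift a map `J → C` to `G : Rⁿ → E` on a
  -- presentation of the ideal `J`. On the relations `G` takes values in `M`, and that part extends
  -- to `Rⁿ` because `J` is torsion-free. Subtracting it gives a map `J → E`, which extends to `R`.
  have hC : Module.Injective R C := by
    refine Module.Baer.injective fun J g => ?_
    obtain ⟨n, f, hf⟩ := Module.Finite.exists_fin' R J
    obtain ⟨G, hG⟩ := Module.projective_lifting_property (LinearMap.range i).mkQ (g ∘ₗ f)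
      (Submodule.mkQ_surjective _)
    have hker : ∀ y : LinearMap.ker f, (G ∘ₗ (LinearMap.ker f).subtype) y ∈ LinearMap.range i := by
      intro y
      rw [← Submodule.Quotient.mk_eq_zero]
      refine (LinearMap.congr_fun hG y).trans ?_
      rw [LinearMap.comp_apply, LinearMap.mem_ker.mp y.2, map_zero]
    obtain ⟨φ, hφ⟩ := h n (LinearMap.ker f) (fun v hv => by
        rw [LinearMap.mem_ker, map_smul] at hv
        ext
        have h1 := congrArg Subtype.val hv
        exact (mul_left_mem_nonZeroDivisors_eq_zero_iff hx).mp h1)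
      ((LinearEquiv.ofInjective i hi).symm.toLinearMap ∘ₗ
        (G ∘ₗ (LinearMap.ker f).subtype).codRestrict (LinearMap.range i) hker)
    have hle : LinearMap.ker f ≤ LinearMap.ker (G - i ∘ₗ φ) := by
      intro y hy
      rw [LinearMap.mem_ker, LinearMap.sub_apply, LinearMap.comp_apply, hφ ⟨y, hy⟩, sub_eq_zero]
      have := congrArg Subtype.val ((LinearEquiv.ofInjective i hi).apply_symm_apply
        ((G ∘ₗ (LinearMap.ker f).subtype).codRestrict (LinearMap.range i) hker ⟨y, hy⟩))
      exact this.symm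
    obtain ⟨ψ, hψ⟩ := Module.Baer.of_injective hE J
      ((LinearMap.ker f).liftQ (G - i ∘ₗ φ) hle ∘ₗ (f.quotKerEquivOfSurjective hf).symm.toLinearMap)
    refine ⟨(LinearMap.range i).mkQ ∘ₗ ψ, fun y hy => ?_⟩
    obtain ⟨v, hv⟩ := hf ⟨y, hy⟩
    have h2 : (f.quotKerEquivOfSurjective hf).symm ⟨y, hy⟩ = Submodule.Quotient.mk v := by
      rw [LinearEquiv.symm_apply_eq, ← hv]
      rfl
    rw [LinearMap.comp_apply, hψ y hy, LinearMap.comp_apply, LinearEquiv.coe_coe, h2,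
      Submodule.liftQ_apply, LinearMap.sub_apply, map_sub]
    have h3 := LinearMap.congr_fun hG v
    rw [LinearMap.comp_apply, LinearMap.comp_apply, hv] at h3
    rw [h3, sub_eq_self]
    exact (Submodule.Quotient.mk_eq_zero _).mpr ⟨φ v, rfl⟩
  have hex : Function.Exact i (LinearMap.range i).mkQ := by
    rw [LinearMap.exact_iff, Submodule.ker_mkQ]
  have hS := modShortComplex_shortExact hex hi (Submodule.mkQ_surjective _)
  have h1 : Injective (ModuleCat.of R E) := Module.injective_object_of_injective_module R E
  have h2 : Injective (ModuleCat.of R C) := Module.injective_object_of_injective_module R C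
  refine hS.hasInjectiveDimensionLT_X₁ 1 ?_ ?_
  · exact inferInstanceAs (HasInjectiveDimensionLT (ModuleCat.of R C) 1)
  · exact inferInstanceAs (HasInjectiveDimensionLT (ModuleCat.of R E) (1 + 1))

variable [IsLocalRing R]

theorem isCanonicalModule_of_hasTorsionFreeExtension [IsNoetherianRing R]
    (h : HasTorsionFreeExtension x M) (h1 : HasTypeOne R M) (hx : x ∈ maximalIdeal R)
    (hreg : x ∈ nonZeroDivisors R) (hM : IsSMulRegular M x) (hfin : Module.Finite R M) :
    IsCanonicalModule R M where
  finite := hfin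
  exists_regular := ⟨x, hx, hM⟩
  type_eq_one := length_ext_residueField_eq_one_iff.mpr h1
  finite_injectiveDimension := ⟨2, h.hasInjectiveDimensionLT_two hreg⟩

theorem IsCanonicalModule.hasTypeOne (h : IsCanonicalModule R M) : HasTypeOne R M :=
  length_ext_residueField_eq_one_iff.mp h.type_eq_one

theorem IsCanonicalModule.hasTorsionFreeExtension (h : IsCanonicalModule R M)
    (hR : IsCohenMacaulayDimOne R) (hx : x ∈ maximalIdeal R) : HasTorsionFreeExtension x M := by
  have := h.finite
  obtain ⟨n, hn⟩ := h.finite_injectiveDimension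
  exact hasTorsionFreeExtension_of_hasInjectiveDimensionLT hR hn hx

end

/-! ### Coinduced modules `Hom_R(A, M)`. -/

section Transfer

open IsLocalRing

variable {R A : Type u} [CommRing R] [CommRing A] [Algebra R A] {M J : Type u}
  [AddCommGroup M] [Module R M] [AddCommGroup J] [Module R J] [Module A J] [IsScalarTower R A J]
  (φ : J →ₗ[R] M) (hinj : ∀ z, (∀ a : A, φ (a • z) = 0) → z = 0)
  (hsurj : ∀ g : A →ₗ[R] M, ∃ z, ∀ a, φ (a • z) = g a)
include hinj hsurj

/-- The torsion-free extension property passes from `M` to the coinduced module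
`J ≃ Hom_R(A, M)`. -/
theorem HasTorsionFreeExtension.coinduced [Module.Finite R A] {x : R}
    (h : HasTorsionFreeExtension x M) : HasTorsionFreeExtension (algebraMap R A x) J := by
  intro n N hN g
  obtain ⟨ψ, hψ⟩ := h.exists_extension (N.restrictScalars R)
    (fun v hv => hN v (by rwa [algebraMap_smul])) (φ ∘ₗ g.restrictScalars R)
  -- The adjunction `Hom_A(F, Hom_R(A, M)) = Hom_R(F, M)`, with `z : J` standing for the functional
  -- `a ↦ φ (a • z)`.
  have hz : ∀ v : Fin n → A, ∃ z : J, ∀ a : A, φ (a • z) = ψ (a • v) := by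
    intro v
    exact hsurj (ψ ∘ₗ (LinearMap.toSpanSingleton A (Fin n → A) v).restrictScalars R)
  choose f hf using hz
  have heq : ∀ z z' : J, (∀ a : A, φ (a • z) = φ (a • z')) → z = z' := by
    intro z z' hzz
    rw [← sub_eq_zero]
    exact hinj _ fun a => by rw [smul_sub, map_sub, hzz, sub_self]
  refine ⟨{ toFun := f, map_add' := fun v w => heq _ _ fun a => ?_,
            map_smul' := fun b v => heq _ _ fun a => ?_ }, fun y => heq _ _ fun a => ?_⟩
  · rw [hf, smul_add, smul_add, map_add, map_add, hf, hf]
  · rw [hf, RingHom.id_apply, smul_smul, smul_smul, hf]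
  · change φ (a • f y) = _
    rw [hf, ← map_smul g]
    exact hψ (a • y)

/-- Type one passes from `M` to the coinduced module `J ≃ Hom_R(A, M)` for an augmented algebra
`A`. -/
theorem HasTypeOne.coinduced [IsLocalRing R] [IsLocalRing A] (ε : A →ₐ[R] R)
    (h : HasTypeOne R M) : HasTypeOne A J := by
  have heq : ∀ z z' : J, (∀ a : A, φ (a • z) = φ (a • z')) → z = z' := by
    intro z z' hzz
    rw [← sub_eq_zero]
    exact hinj _ fun a => by rw [smul_sub, map_sub, hzz, sub_self]
  have hεR : ∀ r, ε (algebraMap R A r) = r := fun r => ε.commutes r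
  have hsub : ∀ a, a - algebraMap R A (ε a) ∈ maximalIdeal A := by
    intro a
    rw [mem_maximalIdeal, mem_nonunits_iff]
    intro hu
    have := hu.map ε
    rw [map_sub, hεR, sub_self] at this
    exact not_isUnit_zero this
  have hε : ∀ y ∈ maximalIdeal A, ε y ∈ maximalIdeal R := by
    intro y hy hu
    have h3 := Ideal.sub_mem _ hy (hsub y)
    rw [sub_sub_cancel] at h3
    exact h3 (hu.map _)
  have hm : ∀ y ∈ maximalIdeal R, algebraMap R A y ∈ maximalIdeal A := by
    intro y hy hu
    have := hu.map ε
    rw [hεR] at this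
    exact hy this
  obtain ⟨h₀, h1, h2⟩ := h
  have hz : ∀ y : maximalIdeal A, ∃ z : J, ∀ a : A,
      φ (a • z) = h₀ ⟨ε (a * y), hε _ (Ideal.mul_mem_left _ a y.2)⟩ := by
    intro y
    refine hsurj (h₀ ∘ₗ ((ε.toLinearMap ∘ₗ LinearMap.mulRight R (y : A)).codRestrict
      (maximalIdeal R) fun a => hε _ (Ideal.mul_mem_left _ a y.2)))
  choose H hH using hz
  refine ⟨{ toFun := H, map_add' := fun v w => heq _ _ fun a => ?_,
            map_smul' := fun b v => heq _ _ fun a => ?_ }, ?_, fun f => ?_⟩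
  · rw [hH, smul_add, map_add, hH, hH, ← map_add]
    congr 1
    ext
    simp [mul_add]
  · rw [hH, RingHom.id_apply, smul_smul, hH]
    congr 1
    ext
    simp [mul_assoc]
  · rintro ⟨w, hw⟩
    refine h1 ⟨φ w, fun y => ?_⟩
    have h3 := hH ⟨algebraMap R A y, hm y y.2⟩ 1
    have h4 : H ⟨algebraMap R A y, hm y y.2⟩ = _ := hw ⟨algebraMap R A y, hm y y.2⟩
    rw [h4, one_smul, algebraMap_smul, map_smul] at h3
    rw [h3]
    congr 1
    ext
    simp
  · obtain ⟨r, z, hrz⟩ := h2 (φ ∘ₗ (f.restrictScalars R) ∘ₗ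
      ((Algebra.linearMap R A).restrict (p := maximalIdeal R)
        (q := (maximalIdeal A).restrictScalars R) hm))
    -- The maximal ideal of `A` is that of `R` plus the kernel of `ε`. On the first summand type one
    -- over `R` supplies `r` and `z`; on the second the whole of `φ ∘ f` is absorbed into the
    -- functional `w`.
    obtain ⟨w, hw⟩ := hsurj (LinearMap.toSpanSingleton R M z ∘ₗ ε.toLinearMap +
      φ ∘ₗ (f.restrictScalars R) ∘ₗ ((LinearMap.id - Algebra.linearMap R A ∘ₗ
        ε.toLinearMap).codRestrict ((maximalIdeal A).restrictScalars R) hsub))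
    refine ⟨algebraMap R A r, w, fun y => heq _ _ fun a => ?_⟩
    have h5 : ∀ y : maximalIdeal A, φ (f y) =
        r • h₀ ⟨ε y, hε _ y.2⟩ + φ ((y : A) • w) := by
      intro y
      rw [hw]
      have h6 := hrz ⟨ε y, hε _ y.2⟩
      have h7 : y = ⟨algebraMap R A (ε y), hm _ (hε _ y.2)⟩ +
          ⟨(y : A) - algebraMap R A (ε y), hsub y⟩ := by
        ext
        simp
      have h8 : φ (f y) = φ (f ⟨algebraMap R A (ε y), hm _ (hε _ y.2)⟩) +
          φ (f ⟨(y : A) - algebraMap R A (ε y), hsub y⟩) := by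
        rw [← map_add, ← map_add, ← h7]
      rw [h8]
      refine (congrArg (· + φ (f ⟨(y : A) - algebraMap R A (ε y), hsub y⟩)) h6).trans ?_
      rw [add_assoc]
      rfl
    have h9 := h5 (a • y)
    rw [map_smul] at h9
    rw [h9, smul_add, map_add, algebraMap_smul]
    change _ = φ (a • r • H y) + _
    rw [smul_comm a r (H y), map_smul φ r, hH, smul_smul a (y : A) w]
    rfl

end Transfer

/-! ### Duality for regular ideals and uniqueness of the canonical ideal. -/

section Duality

open IsLocalRing

variable {R : Type u} [CommRing R]

/-- Duality `I : (I : F) = F` for regular fractional ideals, in terms of ideals of `R`. -/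
def IsDualizing (I : Ideal R) : Prop :=
  ∀ f ∈ nonZeroDivisors R, ∀ F : Ideal R, f ∈ F → ∀ r ∉ F,
    ∃ s, (∀ y ∈ F, s * y ∈ Ideal.span {f} * I) ∧ s * r ∉ Ideal.span {f} * I

theorem mul_mem_span_singleton_mul_iff {f g : R} (hg : g ∈ nonZeroDivisors R) {I : Ideal R} :
    g * f ∈ Ideal.span {g} * I ↔ f ∈ I := by
  rw [Ideal.mem_span_singleton_mul]
  constructor
  · rintro ⟨z, hz, h⟩
    rwa [← (mul_cancel_left_mem_nonZeroDivisors hg).mp h]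
  · exact fun h => ⟨f, h, rfl⟩

theorem IsCohenMacaulayDimOne.exists_pow_le_span [IsLocalRing R] (hR : IsCohenMacaulayDimOne R)
    {f : R} (hf : f ∈ nonZeroDivisors R) :
    ∃ k : ℕ, maximalIdeal R ^ k ≤ Ideal.span {f} := by
  have := hR.isNoetherianRing
  by_cases hfm : f ∈ maximalIdeal R
  · have := hR.isArtinianRing_quotient hfm hf
    have : Nontrivial (R ⧸ Ideal.span {f}) :=
      Ideal.Quotient.nontrivial_iff.mpr (ne_top_of_le_ne_top (maximalIdeal.isMaximal R).ne_top
        ((Ideal.span_singleton_le_iff_mem _).mpr hfm))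
    have : IsLocalRing (R ⧸ Ideal.span {f}) :=
      IsLocalRing.of_surjective' (Ideal.Quotient.mk _) Ideal.Quotient.mk_surjective
    obtain ⟨k, hk⟩ := (isArtinianRing_iff_isNilpotent_maximalIdeal (R ⧸ Ideal.span {f})).mp
      inferInstance
    refine ⟨k, ?_⟩
    rw [← Ideal.mk_ker (I := Ideal.span {f}), ← Ideal.map_eq_bot_iff_le_ker, Ideal.map_pow,
      ← le_bot_iff, ← Ideal.zero_eq_bot, ← hk]
    refine Ideal.pow_right_mono ?_ k
    refine Ideal.map_le_iff_le_comap.mpr fun y hy hu => ?_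
    obtain ⟨z, hz⟩ := hu.exists_right_inv
    obtain ⟨z, rfl⟩ := Ideal.Quotient.mk_surjective z
    rw [← map_mul, ← map_one (Ideal.Quotient.mk _), Ideal.Quotient.eq] at hz
    have h1 := ((Ideal.span_singleton_le_iff_mem _).mpr hfm) hz
    exact (maximalIdeal.isMaximal R).ne_top ((Ideal.eq_top_iff_one _).mpr
      ((Submodule.sub_mem_iff_right _ (Ideal.mul_mem_right z _ hy)).mp h1))
  · refine ⟨0, ?_⟩
    rw [mem_maximalIdeal, mem_nonunits_iff, not_not] at hfm
    rw [Ideal.span_singleton_eq_top.mpr hfm]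
    exact le_top

/-- Replace `r` by a multiple `u = r t` in the socle of `R / F`. The relations `p u + y = 0` in `R ×
F` form a copy `N` of the maximal ideal with torsion-free quotient, so the exotic map `h₀` extends
from `N` to `ψ` on `R × F`. On `F`, `ψ` is multiplication by `s / f` with `s = ψ (0, f)`. If `s r`
were in `f I`, then `h₀` would be multiplication by an element of `I`. -/
theorem isDualizing_of_hasTorsionFreeExtension [IsLocalRing R] (hR : IsCohenMacaulayDimOne R)
    {I : Ideal R} {x : R} (hx : x ∈ nonZeroDivisors R) (hI : HasTorsionFreeExtension x I)
    (h1 : HasTypeOne R I) : IsDualizing I := by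
  have := hR.isNoetherianRing
  intro f hf F hfF r hr
  obtain ⟨u, ⟨t, rfl⟩, hu, hmu⟩ : ∃ u, r ∣ u ∧ u ∉ F ∧ ∀ p ∈ maximalIdeal R, p * u ∈ F := by
    obtain ⟨k, hk⟩ := hR.exists_pow_le_span hf
    have hex : ∃ k : ℕ, ∀ p ∈ maximalIdeal R ^ k, p * r ∈ F := ⟨k, fun p hp =>
      Ideal.mul_mem_right _ _ (((Ideal.span_singleton_le_iff_mem F).mpr hfF) (hk hp))⟩
    classical
    obtain ⟨j, hj⟩ : ∃ j, Nat.find hex = j + 1 := by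
      refine Nat.exists_eq_succ_of_ne_zero fun h0 => hr ?_
      have := Nat.find_spec hex 1
      rw [h0] at this
      simpa using this
    have hnot := Nat.find_min hex (m := j) (by omega)
    push Not at hnot
    obtain ⟨t, ht, htr⟩ := hnot
    refine ⟨r * t, dvd_mul_right _ _, by rwa [mul_comm], fun p hp => ?_⟩
    have := Nat.find_spec hex (t * p)
    rw [hj, pow_succ] at this
    have h2 := this (Ideal.mul_mem_mul ht hp)
    convert h2 using 1
    ring
  obtain ⟨h₀, hh₀, -⟩ := h1
  let N : Submodule R (R × F) :=
    LinearMap.ker ((LinearMap.mulRight R (r * t)).coprod F.subtype)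
  have hN : ∀ v : R × F, v ∈ N ↔ v.1 * (r * t) + v.2 = 0 := fun v => Iff.rfl
  have hNm : ∀ v : N, (v : R × F).1 ∈ maximalIdeal R := by
    intro v hv
    have h2 := (hN v).mp v.2
    have h3 : (v : R × F).1 * (r * t) ∈ F := by
      rw [eq_neg_of_add_eq_zero_left h2]
      exact F.neg_mem (v : R × F).2.2
    exact hu ((Ideal.unit_mul_mem_iff_mem F hv).mp h3)
  obtain ⟨ψ, hψ⟩ := hI.exists_extension N (fun v hv => by
      rw [hN] at hv ⊢
      refine (mul_left_mem_nonZeroDivisors_eq_zero_iff hx).mp ?_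
      rw [← hv]
      change x * (v.1 * (r * t) + v.2) = (x * v.1) * (r * t) + x * v.2
      ring)
    (h₀ ∘ₗ (LinearMap.fst R R F ∘ₗ N.subtype).codRestrict (maximalIdeal R) hNm)
  have hψf : ∀ y : F, f * (ψ (0, y) : R) = ψ (0, ⟨f, hfF⟩) * y := by
    intro y
    have h2 : f • ψ (0, y) = (y : R) • ψ (0, ⟨f, hfF⟩) := by
      rw [← map_smul, ← map_smul]
      congr 1
      ext
      · simp
      · exact mul_comm _ _
    rw [mul_comm _ (y : R)]
    exact congrArg Subtype.val h2
  refine ⟨ψ (0, ⟨f, hfF⟩), fun y hy => ?_, fun hsr => hh₀ ?_⟩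
  · rw [← hψf ⟨y, hy⟩, mul_mem_span_singleton_mul_iff hf]
    exact (ψ _).2
  · obtain ⟨w, hw, hfw⟩ := Ideal.mem_span_singleton_mul.mp hsr
    refine ⟨ψ (1, 0) - t • ⟨w, hw⟩, fun p => ?_⟩
    have hmem : ((p : R), -(⟨(p : R) * (r * t), hmu p p.2⟩ : F)) ∈ N := by
      rw [hN]
      simp
    have h3 := hψ ⟨_, hmem⟩
    have h4 : ((p : R), -(⟨(p : R) * (r * t), hmu p p.2⟩ : F)) =
        (p : R) • ((1 : R), (0 : F)) - (0, (⟨(p : R) * (r * t), hmu p p.2⟩ : F)) := by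
      ext <;> simp
    have h5 : ψ (0, (⟨(p : R) * (r * t), hmu p p.2⟩ : F)) = (p : R) • t • (⟨w, hw⟩ : I) := by
      ext
      refine (mul_cancel_left_mem_nonZeroDivisors hf).mp ?_
      rw [hψf]
      change _ * ((p : R) * (r * t)) = f * (p * (t * w))
      linear_combination (-(p : R) * t) * hfw
    rw [smul_sub, ← h5, ← map_smul, ← map_sub, ← h4, h3]
    rfl

theorem exists_linearMap_of_mul_mem {f q : R} (hf : f ∈ nonZeroDivisors R) {I J : Ideal R}
    (h : ∀ t ∈ J, q * t ∈ Ideal.span {f} * I) :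
    ∃ g : J →ₗ[R] I, ∀ t, f * (g t : R) = q * t := by
  have : ∀ t : J, ∃ c : I, f * (c : R) = q * t := by
    intro t
    obtain ⟨c, hc, h1⟩ := Ideal.mem_span_singleton_mul.mp (h t t.2)
    exact ⟨⟨c, hc⟩, h1⟩
  choose g hg using this
  refine ⟨{ toFun := g, map_add' := fun s t => ?_, map_smul' := fun r t => ?_ }, hg⟩
  · ext
    refine (mul_cancel_left_mem_nonZeroDivisors hf).mp ?_
    rw [hg]
    push_cast
    rw [mul_add, mul_add, hg, hg]
  · ext
    refine (mul_cancel_left_mem_nonZeroDivisors hf).mp ?_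
    rw [hg]
    change q * (r * t) = f * (r * g t)
    rw [mul_left_comm, ← hg, mul_left_comm]

/-- Uniqueness of the canonical ideal up to multiplication by elements of the total ring of
fractions. -/
theorem IsDualizing.exists_span_mul_eq [IsLocalRing R] (hR : IsCohenMacaulayDimOne R)
    {I I' : Ideal R} (hI : IsDualizing I) (h1 : HasTypeOne R I') {a b : R}
    (ha : a ∈ nonZeroDivisors R) (haI : a ∈ I) (hb : b ∈ nonZeroDivisors R) (hbI : b ∈ I') :
    ∃ u ∈ nonZeroDivisors R, ∃ v ∈ nonZeroDivisors R,
      Ideal.span {u} * I = Ideal.span {v} * I' := by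
  have := hR.isNoetherianRing
  obtain ⟨x, hx, hxr⟩ := hR.exists_regular
  -- `F / b` is the fractional ideal `I : I'`. The goal is that `F` is principal; then `I' = I : (I
  -- : I')` is a multiple of `I`.
  let F : Ideal R :=
    { carrier := {s | ∀ y ∈ I', s * y ∈ Ideal.span {b} * I}
      add_mem' := fun {s t} hs ht y hy => by
        rw [add_mul]
        exact Ideal.add_mem _ (hs y hy) (ht y hy)
      zero_mem' := fun y _ => by
        rw [zero_mul]
        exact Ideal.zero_mem _
      smul_mem' := fun c s hs y hy => by
        rw [smul_eq_mul, mul_assoc]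
        exact Ideal.mul_mem_left _ c (hs y hy) }
  have hF : ∀ s, s ∈ F ↔ ∀ y ∈ I', s * y ∈ Ideal.span {b} * I := fun s => Iff.rfl
  -- The inclusion `I : (I : I') ⊆ I'`, with denominator `g`.
  have hdual : ∀ g ∈ nonZeroDivisors R, ∀ r, (∀ s ∈ F, r * s ∈ Ideal.span {g * b} * I) →
      r ∈ Ideal.span {g} * I' := by
    intro g hg r hr
    by_contra hcon
    obtain ⟨s, hs, hsr⟩ := hI (g * b) (mul_mem hg hb) (Ideal.span {g} * I')
      ((mul_mem_span_singleton_mul_iff hg).mpr hbI) r hcon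
    refine hsr ?_
    rw [mul_comm s r]
    refine hr s fun y hy => ?_
    obtain ⟨i, hi, h2⟩ := Ideal.mem_span_singleton_mul.mp
      (hs (g * y) ((mul_mem_span_singleton_mul_iff hg).mpr hy))
    refine Ideal.mem_span_singleton_mul.mpr ⟨i, hi, ?_⟩
    refine (mul_cancel_left_mem_nonZeroDivisors hg).mp ?_
    linear_combination h2
  have hba : b * a ∈ F := fun y _ => by
    rw [mul_assoc, mul_mem_span_singleton_mul_iff hb]
    exact Ideal.mul_mem_right _ _ haI
  have hbar : b * a ∈ nonZeroDivisors R := mul_mem hb ha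
  obtain ⟨w, hwF, hwm⟩ : ∃ w ∈ F, w ∉ maximalIdeal R * F := by
    by_contra! hcon
    have hbot := Submodule.eq_bot_of_le_smul_of_le_jacobson_bot (maximalIdeal R) F
      (IsNoetherian.noetherian F) hcon (maximalIdeal_le_jacobson _)
    rw [hbot] at hba
    exact nonZeroDivisors.ne_zero hbar hba
  set f := x * (b * a) with hf
  have hfr : f ∈ nonZeroDivisors R := mul_mem hxr hbar
  have hfmF : f ∈ maximalIdeal R * F := Ideal.mul_mem_mul hx hba
  have hhom : ∀ σ, (∀ g ∈ maximalIdeal R * F, σ * g ∈ Ideal.span {f} * I) →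
      ∃ h : maximalIdeal R →ₗ[R] I', ∀ t, f * (h t : R) = (σ * b) * t := by
    intro σ hσ
    refine exists_linearMap_of_mul_mem hfr fun t ht => hdual f hfr _ fun v hv => ?_
    obtain ⟨i, hi, h2⟩ := Ideal.mem_span_singleton_mul.mp (hσ _ (Ideal.mul_mem_mul ht hv))
    exact Ideal.mem_span_singleton_mul.mpr ⟨i, hi, by linear_combination b * h2⟩
  have hscal : ∀ σ, ∀ z ∈ I', σ * b * x = f * (x * z) → ∀ y ∈ F,
      σ * y ∈ Ideal.span {f} * I := by
    intro σ z hz hσ y hy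
    obtain ⟨i, hi, h2⟩ := Ideal.mem_span_singleton_mul.mp (hy z hz)
    refine Ideal.mem_span_singleton_mul.mpr ⟨i, hi, ?_⟩
    refine (mul_cancel_left_mem_nonZeroDivisors (mul_mem hb hxr)).mp ?_
    linear_combination (-y) * hσ + f * x * h2
  -- If `F / 𝔪F` had dimension at least two, duality would give `s` separating `F` from `(w) + 𝔪F`
  -- and `s'` separating `w` from `𝔪F`. Both define maps `𝔪 → I'`, with coefficients `r` and `r'` on
  -- `h₀`. If `r` is a unit, `s' - (r' / r) s` sends `F` into `f I`, so `s' w` lies in `f I`. If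
  -- not, `r h₀` is a multiplication and `s` itself sends `F` into `f I`.
  have hle : F ≤ Ideal.span {w} ⊔ maximalIdeal R * F := by
    by_contra hcon
    obtain ⟨y, hy, hyG⟩ := SetLike.not_le_iff_exists.mp hcon
    obtain ⟨s, hs, hsy⟩ := hI f hfr _ (Ideal.mem_sup_right hfmF) y hyG
    obtain ⟨s', hs', hsw⟩ := hI f hfr _ hfmF w hwm
    obtain ⟨h, hh⟩ := hhom s fun g hg => hs g (Ideal.mem_sup_right hg)
    obtain ⟨h', hh'⟩ := hhom s' hs'
    obtain ⟨h₀, -, hgen⟩ := h1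
    obtain ⟨r, z, hz⟩ := hgen h
    obtain ⟨r', z', hz'⟩ := hgen h'
    have hzx := congrArg Subtype.val (hz ⟨x, hx⟩)
    have hzx' := congrArg Subtype.val (hz' ⟨x, hx⟩)
    have hhx := hh ⟨x, hx⟩
    have hhx' := hh' ⟨x, hx⟩
    rw [hzx] at hhx
    rw [hzx'] at hhx'
    change f * (r * h₀ ⟨x, hx⟩ + x * z) = _ at hhx
    change f * (r' * h₀ ⟨x, hx⟩ + x * z') = _ at hhx'
    by_cases hr : IsUnit r
    · obtain ⟨c, hc⟩ := hr.exists_right_inv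
      have h2 := hscal (s' - r' * c * s) (z' - r' * c * z)
        (I'.sub_mem z'.2 (I'.mul_mem_left _ z.2))
        (by
          linear_combination (-1) * hhx' + r' * c * hhx + f * r' * (h₀ ⟨x, hx⟩ : R) * (-1) * hc)
        w hwF
      refine hsw ?_
      have h3 := hs w (Ideal.mem_sup_left (Ideal.mem_span_singleton_self w))
      have h4 := Ideal.add_mem _ h2 (Ideal.mul_mem_left _ (r' * c) h3)
      convert h4 using 1
      ring
    · have h2 : r * (h₀ ⟨x, hx⟩ : R) = x * h₀ ⟨r, hr⟩ := by
        have h3 : r • h₀ ⟨x, hx⟩ = x • h₀ ⟨r, hr⟩ := by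
          rw [← map_smul, ← map_smul]
          congr 1
          ext
          exact mul_comm _ _
        exact congrArg Subtype.val h3
      refine hsy (hscal s (h₀ ⟨r, hr⟩ + z) (I'.add_mem (h₀ ⟨r, hr⟩).2 z.2) ?_ y hy)
      linear_combination (-1) * hhx + f * h2
  have hFw : F ≤ Ideal.span {w} :=
    Submodule.le_of_le_smul_of_le_jacobson_bot (IsNoetherian.noetherian F)
      (maximalIdeal_le_jacobson _) hle
  obtain ⟨w', hw'⟩ := Ideal.mem_span_singleton'.mp (hFw hba)
  have hwr : w ∈ nonZeroDivisors R := by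
    rw [← hw'] at hbar
    exact (mul_mem_nonZeroDivisors.mp hbar).2
  refine ⟨b, hb, w, hwr, le_antisymm ?_ ?_⟩
  · intro y hy
    obtain ⟨i, hi, rfl⟩ := Ideal.mem_span_singleton_mul.mp hy
    have h2 := hdual a ha (w' * i) fun v hv => by
      obtain ⟨c, rfl⟩ := Ideal.mem_span_singleton'.mp (hFw hv)
      exact Ideal.mem_span_singleton_mul.mpr ⟨i * c, Ideal.mul_mem_right _ _ hi,
        by linear_combination (-1) * i * c * hw'⟩
    obtain ⟨i', hi', h3⟩ := Ideal.mem_span_singleton_mul.mp h2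
    refine Ideal.mem_span_singleton_mul.mpr ⟨i', hi', ?_⟩
    refine (mul_cancel_left_mem_nonZeroDivisors ha).mp ?_
    linear_combination w * h3 + i * hw'
  · intro y hy
    obtain ⟨i, hi, rfl⟩ := Ideal.mem_span_singleton_mul.mp hy
    exact hwF i hi

end Duality

/-! ### The rank of the Sally module as a length over `R`. -/

namespace CanonicalSetting

open IsLocalRing TensorProduct

variable {R : Type u} [CommRing R] [IsLocalRing R] (D : CanonicalSetting R)

noncomputable instance isScalarTower_T : IsScalarTower R D.T R[X] :=
  inferInstanceAs (IsScalarTower R (reesAlgebra D.Q) R[X])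

theorem coeff_algebraMap_T_mem (t : D.T) (i : ℕ) : (algebraMap D.T R[X] t).coeff i ∈ D.Q ^ i :=
  t.2 i

theorem Q_le_I : D.Q ≤ D.I := (Ideal.span_singleton_le_iff_mem _).mpr D.a_mem

theorem mem_mulRees {J : Ideal R} (hJ : D.Q ≤ J) {f : R[X]} :
    f ∈ D.mulRees J ↔ ∀ i, f.coeff i ∈ D.I * J ^ i := by
  have hsmul : ∀ (K : Ideal R) (t : D.T) (f : R[X]), (∀ i, f.coeff i ∈ K * J ^ i) →
      ∀ i, (t • f).coeff i ∈ K * J ^ i := by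
    intro K t f hf i
    rw [Algebra.smul_def, coeff_mul]
    refine Ideal.sum_mem _ fun p hp => ?_
    have h1 := Ideal.mul_mem_mul (Ideal.pow_right_mono hJ _ (D.coeff_algebraMap_T_mem t p.1))
      (hf p.2)
    rwa [mul_left_comm, ← pow_add, Finset.HasAntidiagonal.mem_antidiagonal.mp hp] at h1
  constructor
  · let W : Ideal R → Submodule D.T R[X] := fun K =>
      { carrier := {f | ∀ i, f.coeff i ∈ K * J ^ i}
        add_mem' := fun {f g} hf hg i => by
          rw [coeff_add]
          exact Ideal.add_mem _ (hf i) (hg i)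
        zero_mem' := fun i => by simp
        smul_mem' := fun t f hf => hsmul K t f hf }
    suffices D.mulRees J ≤ W D.I from fun h => this h
    refine Submodule.smul_le.mpr fun r hr n hn => ?_
    have hn' : n ∈ W ⊤ := by
      refine (Submodule.span_le (p := W ⊤)).mpr (fun g hg i => ?_) hn
      rw [Ideal.top_mul]
      exact hg i
    have hle : D.I.map (algebraMap R D.T) ≤
        (W D.I).comap (LinearMap.toSpanSingleton D.T R[X] n) := by
      refine Ideal.map_le_iff_le_comap.mpr fun y hy => ?_
      change (algebraMap R D.T y) • n ∈ W D.I
      rw [algebraMap_smul]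
      intro i
      rw [coeff_smul, smul_eq_mul]
      have := hn' i
      rw [Ideal.top_mul] at this
      exact Ideal.mul_mem_mul hy this
    exact hle hr
  · intro hf
    rw [f.as_sum_support]
    refine Submodule.sum_mem _ fun i _ => ?_
    refine Submodule.mul_induction_on (hf i) (fun x hx y hy => ?_) fun x y hx hy => ?_
    · have h1 : monomial i (x * y) = (algebraMap R D.T x) • (monomial i y : R[X]) := by
        rw [algebraMap_smul, smul_monomial, smul_eq_mul]
      rw [h1]
      exact Submodule.smul_mem_smul (Ideal.mem_map_of_mem _ hx)
        (Submodule.subset_span (reesAlgebra.monomial_mem.mpr hy))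
    · rw [map_add]
      exact Submodule.add_mem _ hx hy

theorem Q_pow (n : ℕ) : D.Q ^ n = Ideal.span {D.a ^ n} := Ideal.span_singleton_pow _ _

/-- The `R`-basis `1, at, (at)², …` of `𝒯`. -/
noncomputable def basisT : Module.Basis ℕ R D.T :=
  (Polynomial.basisMonomials R).map
    (AlgEquiv.ofBijective D.toT D.toT_bijective).toLinearEquiv

theorem algebraMap_basisT (i : ℕ) :
    algebraMap D.T R[X] (D.basisT i) = monomial i (D.a ^ i) := by
  have h : algebraMap D.T R[X] (D.basisT i) = (D.toT (monomial i 1) : R[X]) := by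
    simp only [basisT]
    rfl
  rw [h]
  ext n
  rw [coeff_toT, coeff_monomial, coeff_monomial]
  split_ifs with h
  · rw [h, mul_one]
  · rw [mul_zero]

theorem basisT_smul_monomial (i n : ℕ) (c : R) :
    D.basisT i • (monomial n c : R[X]) = monomial (n + i) (D.a ^ i * c) := by
  rw [Algebra.smul_def, algebraMap_basisT, monomial_mul_monomial, add_comm]

/-- The graded piece `I ^ (n + 1) / Q ^ n I` of the Sally module. -/
abbrev SallyPiece (n : ℕ) : Type u :=
  ↥(D.I ^ (n + 1)) ⧸ (Ideal.span {D.a ^ n} * D.I).submoduleOf (D.I ^ (n + 1))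

theorem monomial_mem_mulRees {n : ℕ} {c : R} (hc : c ∈ D.I ^ (n + 1)) :
    monomial n c ∈ D.mulRees D.I := by
  rw [D.mem_mulRees D.Q_le_I]
  intro i
  rw [coeff_monomial]
  split_ifs with h
  · rwa [← pow_succ', ← h]
  · exact Ideal.zero_mem _

/-- The inclusion of a graded piece into the Sally module. -/
noncomputable def sallyPieceMap (n : ℕ) : D.SallyPiece n →ₗ[R] D.Sally :=
  Submodule.liftQ _
    (((D.mulRees D.Q).submoduleOf (D.mulRees D.I)).mkQ.restrictScalars R ∘ₗ
      { toFun := fun c => (⟨monomial n (c : R), D.monomial_mem_mulRees c.2⟩ : D.mulRees D.I)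
        map_add' := fun c d => by
          ext1
          exact map_add (monomial n) (c : R) d
        map_smul' := fun r c => by
          ext1
          exact map_smul (monomial n) r (c : R) })
    (fun c hc => by
      refine (Submodule.Quotient.mk_eq_zero _).mpr ?_
      change monomial n (c : R) ∈ D.mulRees D.Q
      rw [D.mem_mulRees le_rfl]
      intro i
      rw [coeff_monomial]
      split_ifs with h
      · rw [← h, mul_comm, Q_pow]
        exact hc
      · exact Ideal.zero_mem _)

theorem sallyPieceMap_mk (n : ℕ) (c : ↥(D.I ^ (n + 1))) :
    D.sallyPieceMap n (Submodule.Quotient.mk c) =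
      Submodule.Quotient.mk ⟨monomial n (c : R), D.monomial_mem_mulRees c.2⟩ := rfl

theorem pow_add_succ {n : ℕ} (hn : D.I ^ (n + 2) = Ideal.span {D.a} * D.I ^ (n + 1)) (i : ℕ) :
    D.I ^ (n + 1 + i) = Ideal.span {D.a ^ i} * D.I ^ (n + 1) := by
  induction i with
  | zero => simp
  | succ i ih =>
    rw [← add_assoc, pow_succ, ih, mul_assoc, ← pow_succ, hn, ← mul_assoc,
      Ideal.span_singleton_mul_span_singleton, ← pow_succ D.a]

theorem liftBaseChange_sum (n : ℕ) (c : ℕ →₀ D.SallyPiece n) :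
    (D.sallyPieceMap n).liftBaseChange D.T (c.sum fun i l => D.basisT i ⊗ₜ[R] l) =
      Submodule.Quotient.mk ⟨∑ i ∈ c.support, monomial (n + i) (D.a ^ i * ((c i).out : R)),
        Submodule.sum_mem _ fun i _ => by
          rw [← basisT_smul_monomial]
          exact Submodule.smul_mem _ _ (D.monomial_mem_mulRees (c i).out.2)⟩ := by
  rw [Finsupp.sum, map_sum]
  have h1 : ∀ i, (D.sallyPieceMap n).liftBaseChange D.T (D.basisT i ⊗ₜ[R] c i) =
      Submodule.mkQ ((D.mulRees D.Q).submoduleOf (D.mulRees D.I))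
        (D.basisT i • ⟨monomial n ((c i).out : R), D.monomial_mem_mulRees (c i).out.2⟩) := by
    intro i
    rw [LinearMap.liftBaseChange_tmul, map_smul, Submodule.mkQ_apply, ← sallyPieceMap_mk]
    congr 2
    exact (Quotient.out_eq _).symm
  rw [Finset.sum_congr rfl fun i _ => h1 i, ← map_sum]
  change _ = Submodule.mkQ _ _
  congr 1
  ext1
  rw [AddSubmonoidClass.coe_finsetSum]
  exact Finset.sum_congr rfl fun i _ => D.basisT_smul_monomial i n _

/-- In the basis `(at) ^ j` of `𝒯`, the `j`-th coordinate is seen in degree `n + j` multiplied by `a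
^ j`, and the regular factor `a ^ j` cancels from `Q ^ (n + j) I`. -/
theorem liftBaseChange_injective (n : ℕ) :
    Function.Injective ((D.sallyPieceMap n).liftBaseChange D.T) := by
  rw [injective_iff_map_eq_zero]
  intro z hz
  obtain ⟨c, rfl⟩ := TensorProduct.eq_repr_basis_left D.basisT z
  rw [liftBaseChange_sum, Submodule.Quotient.mk_eq_zero] at hz
  have hz' : ∑ i ∈ c.support, monomial (n + i) (D.a ^ i * ((c i).out : R)) ∈ D.mulRees D.Q := hz
  rw [D.mem_mulRees le_rfl] at hz'
  suffices ∀ i ∈ c.support, c i = 0 by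
    rw [Finsupp.sum]
    exact Finset.sum_eq_zero fun i hi => by rw [this i hi, tmul_zero]
  intro j hj
  have h1 := hz' (n + j)
  rw [finsetSum_coeff, Finset.sum_eq_single j, coeff_monomial, if_pos rfl, Q_pow, pow_add,
    mul_comm D.I, ← Ideal.span_singleton_mul_span_singleton, mul_comm (Ideal.span {D.a ^ n}),
    mul_assoc, mul_mem_span_singleton_mul_iff (pow_mem D.a_mem_nonZeroDivisors j)] at h1
  · rw [← Quotient.out_eq (c j)]
    exact (Submodule.Quotient.mk_eq_zero _).mpr h1
  · intro i _ hij
    rw [coeff_monomial, if_neg (by omega)]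
  · exact fun h => absurd hj h

/-- The element `(at) ^ n` kills the cokernel, because `a ^ n I ^ (i + 1) ⊆ I ^ (n + 1 + i) = a ^ i
I ^ (n + 1)`. It lies outside `𝔭`, so the cokernel vanishes on localizing. -/
theorem basisT_smul_mem_range {n : ℕ} (hn : D.I ^ (n + 2) = Ideal.span {D.a} * D.I ^ (n + 1))
    (m : D.Sally) :
    ∃ z, (D.sallyPieceMap n).liftBaseChange D.T z = D.basisT n • m := by
  obtain ⟨⟨f, hf⟩, rfl⟩ := Submodule.Quotient.mk_surjective _ m
  have hf' := (D.mem_mulRees D.Q_le_I).mp hf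
  have h1 : ∀ i, ∃ c : ↥(D.I ^ (n + 1)), D.a ^ i * (c : R) = D.a ^ n * f.coeff i := by
    intro i
    have h2 : D.a ^ n * f.coeff i ∈ D.I ^ (n + 1 + i) := by
      have h3 := Ideal.mul_mem_mul (Ideal.pow_mem_pow D.a_mem n) (hf' i)
      rwa [← pow_succ', ← pow_add, ← add_assoc, add_right_comm] at h3
    rw [D.pow_add_succ hn] at h2
    obtain ⟨c, hc, h3⟩ := Ideal.mem_span_singleton_mul.mp h2
    exact ⟨⟨c, hc⟩, h3⟩
  choose c hc using h1
  refine ⟨∑ i ∈ f.support, D.basisT i ⊗ₜ[R] Submodule.Quotient.mk (c i), ?_⟩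
  rw [map_sum]
  have h4 : ∀ i, (D.sallyPieceMap n).liftBaseChange D.T
      (D.basisT i ⊗ₜ[R] Submodule.Quotient.mk (c i)) =
      Submodule.mkQ ((D.mulRees D.Q).submoduleOf (D.mulRees D.I))
        (D.basisT i • ⟨monomial n (c i : R), D.monomial_mem_mulRees (c i).2⟩) := by
    intro i
    rw [LinearMap.liftBaseChange_tmul, map_smul, Submodule.mkQ_apply, ← sallyPieceMap_mk]
  rw [Finset.sum_congr rfl fun i _ => h4 i, ← map_sum, ← Submodule.mkQ_apply, ← map_smul]
  congr 1
  ext1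
  rw [AddSubmonoidClass.coe_finsetSum]
  change ∑ i ∈ f.support, D.basisT i • (monomial n (c i : R) : R[X]) = D.basisT n • f
  conv_rhs => rw [f.as_sum_support, Finset.smul_sum]
  refine Finset.sum_congr rfl fun i _ => ?_
  rw [basisT_smul_monomial, basisT_smul_monomial, hc, add_comm]

theorem basisT_notMem_p (n : ℕ) : D.basisT n ∉ D.p := by
  have hle : ∀ t ∈ D.p, D.basisT.repr t n ∈ maximalIdeal R := by
    intro t ht
    have ht' : t ∈ (maximalIdeal R • ⊤ : Submodule R D.T) := by
      rw [Ideal.smul_top_eq_map]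
      exact ht
    refine Submodule.smul_induction_on ht' (fun r hr t _ => ?_) fun t t' ht ht' => ?_
    · rw [map_smul, Finsupp.smul_apply]
      exact Ideal.mul_mem_right _ _ hr
    · rw [map_add, Finsupp.add_apply]
      exact Ideal.add_mem _ ht ht'
  intro h
  have := hle _ h
  rw [Module.Basis.repr_self, Finsupp.single_eq_same] at this
  exact (Ideal.ne_top_iff_one _).mp (maximalIdeal.isMaximal R).ne_top this

theorem localizedModule_map_bijective {n : ℕ}
    (hn : D.I ^ (n + 2) = Ideal.span {D.a} * D.I ^ (n + 1)) :
    Function.Bijective (LocalizedModule.map D.p.primeCompl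
      ((D.sallyPieceMap n).liftBaseChange D.T)) := by
  constructor
  · exact IsLocalizedModule.map_injective D.p.primeCompl
      (LocalizedModule.mkLinearMap D.p.primeCompl _) (LocalizedModule.mkLinearMap D.p.primeCompl _)
      _ (D.liftBaseChange_injective n)
  · intro y
    induction y using LocalizedModule.induction_on with
    | h m s =>
      obtain ⟨z, hz⟩ := D.basisT_smul_mem_range hn m
      refine ⟨LocalizedModule.mk z (⟨D.basisT n, D.basisT_notMem_p n⟩ * s), ?_⟩
      refine (IsLocalizedModule.map_LocalizedModules _ _ _ _).trans ?_
      rw [hz]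
      exact LocalizedModule.mk_cancel_common_left ⟨D.basisT n, D.basisT_notMem_p n⟩ s m

/-- The localized Sally module is `𝒯_𝔭 ⊗ I ^ (n + 1) / Q ^ n I`. Base change along `R → 𝒯_𝔭`
multiplies length by that of the closed fibre, which is one since `𝔪𝒯_𝔭` is maximal. -/
theorem sallyRank_eq_length {n : ℕ} (hn : D.I ^ (n + 2) = Ideal.span {D.a} * D.I ^ (n + 1)) :
    D.sallyRank = Module.length R (D.SallyPiece n) := by
  let Tp := Localization.AtPrime D.p
  have hmap : (maximalIdeal R).map (algebraMap R Tp) = maximalIdeal Tp := by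
    rw [IsScalarTower.algebraMap_eq R D.T Tp, ← Ideal.map_map]
    exact Localization.AtPrime.map_eq_maximalIdeal
  have : Module.Free R D.T := Module.Free.of_basis D.basisT
  have : Module.Flat R Tp := Module.Flat.trans R D.T Tp
  have : IsLocalHom (algebraMap R Tp) := by
    refine ((local_hom_TFAE (algebraMap R Tp)).out 2 0).mp hmap.le
  have hres : Module.length Tp (Tp ⧸ (maximalIdeal R).map (algebraMap R Tp)) = 1 := by
    rw [hmap, Module.length_eq_one_iff]
    exact isSimpleModule_iff_quot_maximal.mpr
      ⟨maximalIdeal Tp, maximalIdeal.isMaximal Tp, ⟨LinearEquiv.refl _ _⟩⟩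
  have h1 := IsLocalRing.length_baseChange R Tp (D.SallyPiece n)
  rw [hres, mul_one] at h1
  rw [← h1]
  let e1 := LinearEquiv.ofBijective _ (D.localizedModule_map_bijective hn)
  let e2 := LocalizedModule.equivTensorProduct D.p.primeCompl (D.T ⊗[R] D.SallyPiece n)
  let e3 := TensorProduct.AlgebraTensorModule.cancelBaseChange R D.T Tp Tp (D.SallyPiece n)
  exact (e1.symm ≪≫ₗ e2 ≪≫ₗ e3).length_eq

end CanonicalSetting

/-! ### Lengths of quotients of ideals and independence of choices. -/

section Length

variable {A R X Y : Type u} [CommRing A] [CommRing R] [AddCommGroup X] [Module A X]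
  [AddCommGroup Y] [Module R Y]

theorem length_quotient_eq_of_ker_eq {ε : A →+* R} (hε : Function.Surjective ε)
    (θ : X →ₛₗ[ε] Y) (hθ : Function.Surjective θ) {P : Submodule A X}
    (h : ∀ x, θ x = 0 ↔ x ∈ P) : Module.length A (X ⧸ P) = Module.length R Y := by
  let := ε.toAlgebra
  let : Module A Y := Module.compHom _ ε
  have : IsScalarTower A R Y := .of_algebraMap_smul fun _ _ => rfl
  rw [← Module.length_eq_of_surjective (S := A) (R := R) (M := Y) hε]
  let g : X →ₗ[A] Y :=
    { toFun := θ
      map_add' := map_add θ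
      map_smul' := fun r x => LinearMap.map_smulₛₗ θ r x }
  have hker : P = LinearMap.ker g := by
    ext x
    rw [← h, LinearMap.mem_ker]
    rfl
  exact ((Submodule.quotEquivOfEq _ _ hker).trans (g.quotKerEquivOfSurjective hθ)).length_eq

theorem length_quotient_eq_of_semilinear {ε : A →+* R} (hε : Function.Surjective ε)
    (θ : X →ₛₗ[ε] Y) (hθ : Function.Surjective θ) {P : Submodule A X} {P' : Submodule R Y}
    (h : ∀ x, θ x ∈ P' ↔ x ∈ P) : Module.length A (X ⧸ P) = Module.length R (Y ⧸ P') :=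
  length_quotient_eq_of_ker_eq hε (P'.mkQ.comp θ) (P'.mkQ_surjective.comp hθ) fun x => by
    rw [← h]
    exact Submodule.Quotient.mk_eq_zero P'

/-- The length of `C / B` for ideals `B ≤ C`. -/
noncomputable def relLength (C B : Ideal R) : ℕ∞ :=
  Module.length R (C ⧸ B.submoduleOf C)

theorem relLength_span_singleton_mul {f : R} (hf : f ∈ nonZeroDivisors R) (C B : Ideal R) :
    relLength (Ideal.span {f} * C) (Ideal.span {f} * B) = relLength C B := by
  refine (length_quotient_eq_of_semilinear (ε := RingHom.id R) Function.surjective_id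
    { toFun := fun x : C => (⟨f * x, (mul_mem_span_singleton_mul_iff hf).mpr x.2⟩ :
        ↥(Ideal.span {f} * C))
      map_add' := fun x y => Subtype.ext (mul_add f (x : R) y)
      map_smul' := fun r x => Subtype.ext (mul_left_comm f r (x : R)) } ?_ ?_).symm
  · rintro ⟨y, hy⟩
    obtain ⟨x, hx, rfl⟩ := Ideal.mem_span_singleton_mul.mp hy
    exact ⟨⟨x, hx⟩, rfl⟩
  · intro x
    exact mul_mem_span_singleton_mul_iff hf

end Length

theorem pow_succ_eq_of_reduction {R : Type u} [CommRing R] {I : Ideal R} {a : R} {n m : ℕ}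
    (hn : I ^ (n + 1) = Ideal.span {a} * I ^ n) (hm : n ≤ m) :
    I ^ (m + 1) = Ideal.span {a} * I ^ m := by
  induction m, hm using Nat.le_induction with
  | base => exact hn
  | succ m _ ih => rw [pow_succ, ih, mul_assoc, ← pow_succ, ih]

theorem pow_add_eq_of_reduction {R : Type u} [CommRing R] {I : Ideal R} {a : R} {n : ℕ}
    (hn : I ^ (n + 1) = Ideal.span {a} * I ^ n) (i : ℕ) :
    I ^ (n + i) = Ideal.span {a ^ i} * I ^ n := by
  induction i with
  | zero => simp
  | succ i ih =>
    rw [← add_assoc, pow_succ_eq_of_reduction hn (Nat.le_add_right n i), ih, ← mul_assoc,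
      Ideal.span_singleton_mul_span_singleton, ← pow_succ' a]

/-- The length of `H ^ (n + 1) / αⁿ H` is the same for all reductions `α` of `H`. -/
theorem relLength_eq_of_reductions {R : Type u} [CommRing R] {H : Ideal R} {α β : R} (hα : α ∈ nonZeroDivisors R)
    (hβ : β ∈ nonZeroDivisors R) {n : ℕ} (hα' : H ^ (n + 2) = Ideal.span {α} * H ^ (n + 1))
    (hβ' : H ^ (n + 2) = Ideal.span {β} * H ^ (n + 1)) :
    relLength (H ^ (n + 1)) (Ideal.span {α ^ n} * H) =
      relLength (H ^ (n + 1)) (Ideal.span {β ^ n} * H) := by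
  -- Scaling the first quotient by `β ^ n` and the second by `α ^ n` turns both into `H ^ (2n + 1) /
  -- αⁿ βⁿ H`.
  rw [← relLength_span_singleton_mul (pow_mem hβ n),
    ← relLength_span_singleton_mul (pow_mem hα n) _ (Ideal.span {β ^ n} * H),
    ← pow_add_eq_of_reduction hα', ← pow_add_eq_of_reduction hβ', mul_left_comm]

namespace CanonicalSetting

open IsLocalRing

variable {R : Type u} [CommRing R] [IsLocalRing R] (D D' : CanonicalSetting R)

theorem a_mem_maximalIdeal : D.a ∈ maximalIdeal R :=
  D.isParameter.le (Ideal.le_radical (Ideal.mem_span_singleton_self _))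

theorem hasTorsionFreeExtension : HasTorsionFreeExtension D.a D.I :=
  D.isCanonical.hasTorsionFreeExtension D.isCohenMacaulay D.a_mem_maximalIdeal

theorem isDualizing : IsDualizing D.I :=
  isDualizing_of_hasTorsionFreeExtension D.isCohenMacaulay D.a_mem_nonZeroDivisors
    D.hasTorsionFreeExtension D.isCanonical.hasTypeOne

theorem sallyRank_eq_relLength {n : ℕ} (hn : D.I ^ (n + 2) = Ideal.span {D.a} * D.I ^ (n + 1)) :
    D.sallyRank = relLength (D.I ^ (n + 1)) (Ideal.span {D.a ^ n} * D.I) :=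
  D.sallyRank_eq_length hn

theorem sallyRank_eq_relLength_of_span_mul {n : ℕ}
    (hn : D.I ^ (n + 2) = Ideal.span {D.a} * D.I ^ (n + 1)) {u : R} (hu : u ∈ nonZeroDivisors R) :
    D.sallyRank = relLength ((Ideal.span {u} * D.I) ^ (n + 1))
      (Ideal.span {(u * D.a) ^ n} * (Ideal.span {u} * D.I)) := by
  rw [D.sallyRank_eq_relLength hn, ← relLength_span_singleton_mul (pow_mem hu (n + 1)), mul_pow,
    Ideal.span_singleton_pow, ← mul_assoc, ← mul_assoc, Ideal.span_singleton_mul_span_singleton,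
    Ideal.span_singleton_mul_span_singleton]
  congr 4
  ring

/-- The rank of the Sally module does not depend on the choice of the canonical ideal and its
reduction. -/
theorem sallyRank_eq : D.sallyRank = D'.sallyRank := by
  obtain ⟨u, hu, v, hv, huv⟩ := D.isDualizing.exists_span_mul_eq D.isCohenMacaulay
    D'.isCanonical.hasTypeOne D.a_mem_nonZeroDivisors D.a_mem D'.a_mem_nonZeroDivisors D'.a_mem
  obtain ⟨n, hn⟩ := D.isReduction
  obtain ⟨n', hn'⟩ := D'.isReduction
  -- A common exponent is needed: the ideal `H = uI = vI'` has both `u a` and `v a'` as reductions,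
  -- and the two quotients must share the power `H ^ (n + 1)`.
  have h1 := pow_succ_eq_of_reduction hn (le_add_right (le_max_left n n') : n ≤ max n n' + 1)
  have h2 := pow_succ_eq_of_reduction hn' (le_add_right (le_max_right n n') : n' ≤ max n n' + 1)
  have key : ∀ (E : CanonicalSetting R) (w : R) (m : ℕ),
      E.I ^ (m + 1) = Ideal.span {E.a} * E.I ^ m →
      (Ideal.span {w} * E.I) ^ (m + 1) = Ideal.span {w * E.a} * (Ideal.span {w} * E.I) ^ m := by
    intro E w m hm
    rw [mul_pow, mul_pow, hm, ← Ideal.span_singleton_mul_span_singleton, pow_succ']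
    simp only [mul_assoc, mul_left_comm]
  rw [D.sallyRank_eq_relLength_of_span_mul h1 hu, D'.sallyRank_eq_relLength_of_span_mul h2 hv, huv]
  refine relLength_eq_of_reductions (mul_mem hu D.a_mem_nonZeroDivisors)
    (mul_mem hv D'.a_mem_nonZeroDivisors) ?_ (key D' v _ h2)
  rw [← huv]
  exact key D u _ h1

theorem isTwoAGL_iff : IsTwoAGL R ↔ D.sallyRank = 2 :=
  ⟨fun ⟨D', h⟩ => (D.sallyRank_eq D').trans h, fun h => ⟨D, h⟩⟩

end CanonicalSetting

/-! ### Canonical modules of finite augmented algebras. -/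

section Transfer

open IsLocalRing

/-- The pairing `φ` identifies `J` with `Hom_R(A, M)`, to which both elementary properties pass. It
serves for ring isomorphisms and for idealizations. -/
theorem IsCanonicalModule.coinduced {R A : Type u} [CommRing R] [CommRing A] [Algebra R A]
    [IsLocalRing R] [IsLocalRing A] [Module.Finite R A] [IsNoetherianRing A] {M J : Type u}
    [AddCommGroup M] [Module R M] [AddCommGroup J] [Module R J] [Module A J] [IsScalarTower R A J]
    (hR : IsCohenMacaulayDimOne R) (hM : IsCanonicalModule R M) (ε : A →ₐ[R] R) (φ : J →ₗ[R] M)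
    (hinj : ∀ z, (∀ a : A, φ (a • z) = 0) → z = 0)
    (hsurj : ∀ g : A →ₗ[R] M, ∃ z, ∀ a, φ (a • z) = g a) {x : R} (hx : x ∈ maximalIdeal R)
    (hxA : algebraMap R A x ∈ nonZeroDivisors A) (hJ : IsSMulRegular J (algebraMap R A x))
    (hfin : Module.Finite A J) : IsCanonicalModule A J := by
  refine isCanonicalModule_of_hasTorsionFreeExtension
    ((hM.hasTorsionFreeExtension hR hx).coinduced φ hinj hsurj)
    (hM.hasTypeOne.coinduced φ hinj hsurj ε) (fun hu => hx ?_) hxA hJ hfin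
  have := hu.map ε
  rwa [ε.commutes] at this

theorem isSMulRegular_ideal {R : Type u} [CommRing R] {x : R} (hx : x ∈ nonZeroDivisors R)
    (I : Ideal R) : IsSMulRegular I x := fun _ _ h =>
  Subtype.ext ((mul_cancel_left_mem_nonZeroDivisors hx).mp (congrArg Subtype.val h))

end Transfer

/-! ### Transport along ring isomorphisms. -/

section RingEquiv

open IsLocalRing

variable {R A : Type u} [CommRing R] [CommRing A]

theorem RingEquiv.map_mem_nonZeroDivisors (e : R ≃+* A) {x : R} (hx : x ∈ nonZeroDivisors R) :
    e x ∈ nonZeroDivisors A := by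
  rw [mem_nonZeroDivisors_iff_right]
  intro y hy
  obtain ⟨y, rfl⟩ := e.surjective y
  rw [← map_mul, map_eq_zero_iff e e.injective] at hy
  rw [(mul_right_mem_nonZeroDivisors_eq_zero_iff hx).mp hy, map_zero]

theorem RingEquiv.map_mem_map_iff (e : R ≃+* A) {I : Ideal R} {x : R} :
    e x ∈ I.map e ↔ x ∈ I := by
  rw [Ideal.mem_map_of_equiv]
  exact ⟨fun ⟨y, hy, h⟩ => e.injective h ▸ hy, fun h => ⟨x, h, rfl⟩⟩

variable [IsLocalRing R] [IsLocalRing A]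

theorem RingEquiv.map_mem_maximalIdeal_iff (e : R ≃+* A) {x : R} :
    e x ∈ maximalIdeal A ↔ x ∈ maximalIdeal R := by
  rw [mem_maximalIdeal, mem_maximalIdeal, mem_nonunits_iff, mem_nonunits_iff, isUnit_map_iff]

theorem IsCohenMacaulayDimOne.of_ringEquiv (e : R ≃+* A) (h : IsCohenMacaulayDimOne R) :
    IsCohenMacaulayDimOne A where
  isNoetherianRing :=
    have := h.isNoetherianRing
    isNoetherianRing_of_ringEquiv R e
  ringKrullDim_eq_one := (ringKrullDim_eq_of_ringEquiv e).symm.trans h.ringKrullDim_eq_one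
  exists_regular := by
    obtain ⟨x, hx, hreg⟩ := h.exists_regular
    exact ⟨e x, e.map_mem_maximalIdeal_iff.mpr hx, e.map_mem_nonZeroDivisors hreg⟩

theorem IsCanonicalModule.map_ringEquiv (e : R ≃+* A) (hR : IsCohenMacaulayDimOne R) {I : Ideal R}
    (h : IsCanonicalModule R I) : IsCanonicalModule A (I.map e) := by
  let := e.toRingHom.toAlgebra
  have : IsNoetherianRing A := (hR.of_ringEquiv e).isNoetherianRing
  have : Module.Finite R A := Module.Finite.of_surjective (Algebra.linearMap R A) e.surjective
  obtain ⟨x, hx, hreg⟩ := hR.exists_regular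
  have hxA := e.map_mem_nonZeroDivisors hreg
  let ε : A →ₐ[R] R := { e.symm.toRingHom with commutes' := fun r => e.symm_apply_apply r }
  have hI : ∀ z : I.map e, e.symm z ∈ I := fun z => by
    rw [← e.map_mem_map_iff, e.apply_symm_apply]
    exact z.2
  let φ : I.map e →ₗ[R] I := (ε.toLinearMap ∘ₗ
    ((I.map e).subtype.restrictScalars R)).codRestrict I hI
  refine IsCanonicalModule.coinduced hR h ε φ (fun z hz => ?_) (fun g => ?_) hx hxA
    (isSMulRegular_ideal hxA _) inferInstance
  · have h1 : e.symm ((1 : A) * z) = 0 := congrArg Subtype.val (hz 1)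
    rw [one_mul, map_eq_zero_iff _ e.symm.injective] at h1
    exact Subtype.ext h1
  · refine ⟨⟨e (g 1), e.map_mem_map_iff.mpr (g 1).2⟩, fun a => ?_⟩
    obtain ⟨r, rfl⟩ := e.surjective a
    have h1 : e r = r • (1 : A) := by
      rw [Algebra.smul_def, mul_one]
      rfl
    ext
    change e.symm (e r * e (g 1)) = _
    rw [← map_mul, e.symm_apply_apply, h1, map_smul]
    rfl

namespace CanonicalSetting

/-- Transport of the standing data along a ring isomorphism. -/
def mapRingEquiv (D : CanonicalSetting R) (e : R ≃+* A) : CanonicalSetting A where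
  isCohenMacaulay := D.isCohenMacaulay.of_ringEquiv e
  I := D.I.map e
  I_ne_top h := D.I_ne_top (by
    rw [Ideal.eq_top_iff_one] at h ⊢
    rwa [← map_one e, e.map_mem_map_iff] at h)
  isCanonical := D.isCanonical.map_ringEquiv e D.isCohenMacaulay
  a := e D.a
  isParameter := by
    ext y
    obtain ⟨x, rfl⟩ := e.surjective y
    have h : Ideal.span {e D.a} = (Ideal.span {D.a}).map e := by
      rw [Ideal.map_span, Set.image_singleton]
    rw [e.map_mem_maximalIdeal_iff, ← D.isParameter, Ideal.mem_radical_iff, Ideal.mem_radical_iff]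
    refine exists_congr fun n => ?_
    rw [← map_pow, h, e.map_mem_map_iff]
  a_mem := e.map_mem_map_iff.mpr D.a_mem
  isReduction := by
    obtain ⟨n, hn⟩ := D.isReduction
    refine ⟨n, ?_⟩
    rw [← Ideal.map_pow, hn, Ideal.map_mul, Ideal.map_pow, Ideal.map_span, Set.image_singleton]

theorem sallyRank_mapRingEquiv (D : CanonicalSetting R) (e : R ≃+* A) :
    (D.mapRingEquiv e).sallyRank = D.sallyRank := by
  obtain ⟨n, hn⟩ := D.isReduction
  have h1 := pow_succ_eq_of_reduction hn n.le_succ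
  have hI : ∀ m, (D.mapRingEquiv e).I ^ m = (D.I ^ m).map e := fun m => (Ideal.map_pow e D.I m).symm
  have h2 : (D.mapRingEquiv e).I ^ (n + 2) =
      Ideal.span {(D.mapRingEquiv e).a} * (D.mapRingEquiv e).I ^ (n + 1) := by
    rw [hI, hI, h1, Ideal.map_mul, Ideal.map_span, Set.image_singleton]
    rfl
  have h3 : Ideal.span {(D.mapRingEquiv e).a ^ n} * (D.mapRingEquiv e).I =
      (Ideal.span {D.a ^ n} * D.I).map e := by
    rw [Ideal.map_mul, Ideal.map_span, Set.image_singleton, map_pow]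
    rfl
  rw [(D.mapRingEquiv e).sallyRank_eq_relLength h2, D.sallyRank_eq_relLength h1, h3, hI]
  refine (length_quotient_eq_of_semilinear (ε := e.toRingHom) e.surjective
    { toFun := fun x : ↥(D.I ^ (n + 1)) => (⟨e x, e.map_mem_map_iff.mpr x.2⟩ :
        ↥((D.I ^ (n + 1)).map e))
      map_add' := fun x y => Subtype.ext (map_add e (x : R) y)
      map_smul' := fun r x => Subtype.ext (map_mul e r (x : R)) } ?_ ?_).symm
  · rintro ⟨y, hy⟩
    obtain ⟨x, rfl⟩ := e.surjective y
    exact ⟨⟨x, e.map_mem_map_iff.mp hy⟩, rfl⟩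
  · exact fun x => e.map_mem_map_iff

end CanonicalSetting

theorem IsTwoAGL.of_ringEquiv (e : R ≃+* A) : IsTwoAGL R → IsTwoAGL A :=
  fun ⟨D, hD⟩ => ⟨D.mapRingEquiv e, (D.sallyRank_mapRingEquiv e).trans hD⟩

end RingEquiv

/-! ### Ideals, lengths and the Cohen-Macaulay property in `R ⋉ c`. -/

section Idealization

open IsLocalRing TrivSqZeroExt

variable {R : Type u} [CommRing R] {c : Ideal R}

instance isScalarTower_trivSqZeroExt :
    IsScalarTower R (TrivSqZeroExt R c) (TrivSqZeroExt R c) :=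
  have h := IsScalarTower.right (R := R) (A := TrivSqZeroExt R c)
  h

theorem TrivSqZeroExt.coe_snd_mul (z w : TrivSqZeroExt R c) :
    ((z * w).snd : R) = z.fst * w.snd + w.fst * z.snd := by
  rw [snd_mul, op_smul_eq_smul]
  rfl

/-- The ideal `P × Q` of the idealization `R ⋉ c`. -/
def idealProd (P Q : Ideal R) (h : c * P ≤ Q) : Ideal (TrivSqZeroExt R c) where
  carrier := {z | z.fst ∈ P ∧ (z.snd : R) ∈ Q}
  add_mem' hz hw := ⟨P.add_mem hz.1 hw.1, Q.add_mem hz.2 hw.2⟩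
  zero_mem' := ⟨P.zero_mem, Q.zero_mem⟩
  smul_mem' z w hw := by
    refine ⟨P.mul_mem_left _ hw.1, ?_⟩
    rw [smul_eq_mul, coe_snd_mul]
    exact Q.add_mem (Q.mul_mem_left _ hw.2) (h (mul_comm w.fst _ ▸ Ideal.mul_mem_mul z.snd.2 hw.1))

theorem mem_idealProd {P Q : Ideal R} {h : c * P ≤ Q} {z : TrivSqZeroExt R c} :
    z ∈ idealProd P Q h ↔ z.fst ∈ P ∧ (z.snd : R) ∈ Q := Iff.rfl

/-- Products of the pieces `P × 0` and `0 × Q` already generate everything. Second components live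
in `c`, so `idealProd P Q` only sees `Q ∩ c`; this is why `Q` and `Q'` must lie in `c`. -/
theorem idealProd_mul_idealProd {P Q P' Q' P₂ Q₂ : Ideal R} {h : c * P ≤ Q} {h' : c * P' ≤ Q'}
    {h₂ : c * P₂ ≤ Q₂} (hQ : Q ≤ c) (hQ' : Q' ≤ c) (hP₂ : P₂ = P * P')
    (hQ₂ : Q₂ = P * Q' ⊔ P' * Q) :
    idealProd P Q h * idealProd P' Q' h' = idealProd P₂ Q₂ h₂ := by
  subst hP₂ hQ₂
  apply le_antisymm
  · refine Ideal.mul_le.mpr fun z hz w hw => ⟨Ideal.mul_mem_mul hz.1 hw.1, ?_⟩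
    rw [coe_snd_mul]
    exact Ideal.add_mem _ (Ideal.mem_sup_left (Ideal.mul_mem_mul hz.1 hw.2))
      (Ideal.mem_sup_right (Ideal.mul_mem_mul hw.1 hz.2))
  · set G := idealProd P Q h * idealProd P' Q' h'
    have hinl : P * P' ≤ G.comap (inlHom R c) := by
      refine Ideal.mul_le.mpr fun x hx y hy => ?_
      rw [Ideal.mem_comap, map_mul]
      exact Ideal.mul_mem_mul ⟨hx, Q.zero_mem⟩ ⟨hy, Q'.zero_mem⟩
    let V : Ideal R := ((G.restrictScalars R).comap (inrHom R c)).map c.subtype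
    have hinr : P * Q' ⊔ P' * Q ≤ V := by
      refine sup_le (Ideal.mul_le.mpr fun x hx y hy => ?_) (Ideal.mul_le.mpr fun x hx y hy => ?_)
      · refine ⟨x • ⟨y, hQ' hy⟩, ?_, rfl⟩
        change inr (x • (⟨y, hQ' hy⟩ : c)) ∈ G
        rw [← inl_mul_inr]
        exact Ideal.mul_mem_mul ⟨hx, Q.zero_mem⟩ ⟨P'.zero_mem, hy⟩
      · refine ⟨x • ⟨y, hQ hy⟩, ?_, rfl⟩
        change inr (x • (⟨y, hQ hy⟩ : c)) ∈ G
        rw [← inl_mul_inr, mul_comm]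
        exact Ideal.mul_mem_mul ⟨P.zero_mem, hy⟩ ⟨hx, Q'.zero_mem⟩
    intro z hz
    rw [← inl_fst_add_inr_snd_eq z]
    refine Ideal.add_mem _ (hinl hz.1) ?_
    obtain ⟨q, hq, hqz⟩ := hinr hz.2
    have : q = z.snd := Subtype.ext hqz
    exact this ▸ hq

theorem span_inl_mul_idealProd {P Q P₂ Q₂ : Ideal R} {h : c * P ≤ Q} {h₂ : c * P₂ ≤ Q₂} {b : R}
    (hQ : Q ≤ c) (hP₂ : P₂ = Ideal.span {b} * P) (hQ₂ : Q₂ = Ideal.span {b} * Q) :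
    Ideal.span {(inl b : TrivSqZeroExt R c)} * idealProd P Q h = idealProd P₂ Q₂ h₂ := by
  subst hP₂ hQ₂
  ext z
  rw [Ideal.mem_span_singleton_mul, mem_idealProd]
  constructor
  · rintro ⟨w, hw, rfl⟩
    rw [inl_mul_eq_smul]
    exact ⟨Ideal.mem_span_singleton_mul.mpr ⟨_, hw.1, rfl⟩,
      Ideal.mem_span_singleton_mul.mpr ⟨_, hw.2, rfl⟩⟩
  · rintro ⟨h1, h2⟩
    obtain ⟨p, hp, hpz⟩ := Ideal.mem_span_singleton_mul.mp h1
    obtain ⟨q, hq, hqz⟩ := Ideal.mem_span_singleton_mul.mp h2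
    refine ⟨inl p + inr ⟨q, hQ hq⟩, ⟨?_, ?_⟩, ?_⟩
    · simpa using hp
    · simpa using hq
    rw [mul_add, inl_mul_inl, inl_mul_inr, hpz]
    refine TrivSqZeroExt.ext (by simp) (Subtype.ext (by simpa using hqz))

theorem relLength_idealProd {P Q Q' : Ideal R} {h : c * P ≤ Q} {h' : c * P ≤ Q'} (hQ : Q ≤ c) :
    relLength (idealProd P Q h) (idealProd P Q' h') = relLength Q Q' := by
  let θ : idealProd P Q h →ₛₗ[(fstHom R R c).toRingHom] Q ⧸ Q'.submoduleOf Q :=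
    { toFun := fun z => (Q'.submoduleOf Q).mkQ ⟨((z : TrivSqZeroExt R c).snd : R), z.2.2⟩
      map_add' := fun z w => by
        rw [← map_add]
        rfl
      map_smul' := fun w z => by
        rw [← map_smul, ← sub_eq_zero, ← map_sub]
        -- The second component is linear over the first projection only modulo `c P`, which `Q'`
        -- contains.
        refine (Submodule.Quotient.mk_eq_zero _).mpr (h' ?_)
        have h1 := Ideal.mul_mem_mul w.snd.2 z.2.1
        have h2 : ((w * (z : TrivSqZeroExt R c)).snd : R) - w.fst * (z : TrivSqZeroExt R c).snd =
            w.snd * (z : TrivSqZeroExt R c).fst := by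
          rw [coe_snd_mul]
          ring
        rw [← h2] at h1
        exact h1 }
  have hθ : ∀ z, θ z = 0 ↔ ((z : TrivSqZeroExt R c).snd : R) ∈ Q' := fun z =>
    Submodule.Quotient.mk_eq_zero _
  refine length_quotient_eq_of_ker_eq (fun r => ⟨inl r, rfl⟩) θ (fun y => ?_) fun z => ?_
  · obtain ⟨⟨y, hy⟩, rfl⟩ := Submodule.mkQ_surjective _ y
    exact ⟨⟨inr ⟨y, hQ hy⟩, P.zero_mem, hy⟩, rfl⟩
  · exact (hθ z).trans ⟨fun h1 => ⟨z.2.1, h1⟩, fun h1 => h1.2⟩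

theorem inl_mem_nonZeroDivisors {x : R} (hx : x ∈ nonZeroDivisors R) :
    (inl x : TrivSqZeroExt R c) ∈ nonZeroDivisors (TrivSqZeroExt R c) := by
  rw [mem_nonZeroDivisors_iff_right]
  intro z hz
  rw [mul_comm, inl_mul_eq_smul] at hz
  refine TrivSqZeroExt.ext ?_ (Subtype.ext ?_)
  · exact (mul_left_mem_nonZeroDivisors_eq_zero_iff hx).mp (congrArg TrivSqZeroExt.fst hz)
  · exact (mul_left_mem_nonZeroDivisors_eq_zero_iff hx).mp
      (congrArg (fun w : TrivSqZeroExt R c => (w.snd : R)) hz)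

instance finite_trivSqZeroExt [IsNoetherianRing R] : Module.Finite R (TrivSqZeroExt R c) :=
  inferInstanceAs (Module.Finite R (R × c))

instance isNoetherianRing_trivSqZeroExt [IsNoetherianRing R] :
    IsNoetherianRing (TrivSqZeroExt R c) :=
  IsNoetherianRing.of_finite R _

theorem mem_maximalIdeal_trivSqZeroExt [IsLocalRing R] {z : TrivSqZeroExt R c} :
    z ∈ maximalIdeal (TrivSqZeroExt R c) ↔ z.fst ∈ maximalIdeal R := by
  rw [mem_maximalIdeal, mem_maximalIdeal, mem_nonunits_iff, mem_nonunits_iff,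
    isUnit_iff_isUnit_fst]

/-- The quotient by the regular element `inl x` is a finite `R`-module killed by `x`, hence
Artinian, so the dimension is one. -/
theorem IsCohenMacaulayDimOne.trivSqZeroExt [IsLocalRing R] (h : IsCohenMacaulayDimOne R) :
    IsCohenMacaulayDimOne (TrivSqZeroExt R c) := by
  have := h.isNoetherianRing
  obtain ⟨x, hx, hreg⟩ := h.exists_regular
  have hxA : (inl x : TrivSqZeroExt R c) ∈ maximalIdeal (TrivSqZeroExt R c) :=
    mem_maximalIdeal_trivSqZeroExt.mpr hx
  have hregA := inl_mem_nonZeroDivisors (c := c) hreg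
  have := h.isArtinianRing_quotient hx hreg
  refine ⟨inferInstance, ?_, inl x, hxA, hregA⟩
  let B := TrivSqZeroExt R c ⧸ Ideal.span {(inl x : TrivSqZeroExt R c)}
  have hB : IsFiniteLength R B := isFiniteLength_of_smul_eq_zero (x := x) fun y => by
    obtain ⟨y, rfl⟩ := Ideal.Quotient.mk_surjective y
    rw [← Ideal.Quotient.mkₐ_eq_mk R, ← map_smul, ← inl_mul_eq_smul, Ideal.Quotient.mkₐ_eq_mk,
      Ideal.Quotient.eq_zero_iff_mem]
    exact Ideal.mul_mem_right _ _ (Ideal.mem_span_singleton_self _)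
  have := (isFiniteLength_iff_isNoetherian_isArtinian.mp hB).2
  have : IsArtinianRing B := isArtinian_of_tower R inferInstance
  have : Nontrivial B := Ideal.Quotient.nontrivial_iff.mpr
    (ne_top_of_le_ne_top (maximalIdeal.isMaximal _).ne_top
      ((Ideal.span_singleton_le_iff_mem _).mpr hxA))
  rw [← ringKrullDim_quotient_span_singleton_succ_eq_ringKrullDim_of_mem_nonZeroDivisors hregA hxA,
    ringKrullDimZero_iff_ringKrullDim_eq_zero.mp
      (isArtinianRing_iff_krullDimLE_zero.mp ‹_›),
    zero_add]

end Idealization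

/-! ### The canonical ideal of `R ⋉ 𝔠` and its Sally module. -/

namespace CanonicalSetting

open IsLocalRing TrivSqZeroExt

variable {R : Type u} [CommRing R] [IsLocalRing R] (D : CanonicalSetting R) {n : ℕ}

theorem exists_mem_S_of_mem_pow (m : ℕ) {y : R} (hy : y ∈ D.I ^ m) :
    ∃ s ∈ D.S, algebraMap R (FractionRing R) (D.a ^ m) * s = algebraMap R _ y := by
  induction m generalizing y with
  | zero => exact ⟨algebraMap R _ y, Subalgebra.algebraMap_mem _ _, by simp⟩
  | succ m ih =>
    rw [pow_succ] at hy
    refine Submodule.mul_induction_on hy (fun x hx z hz => ?_) fun x y hx hy => ?_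
    · obtain ⟨s, hs, h1⟩ := ih hx
      obtain ⟨v, hv⟩ := IsLocalization.map_units (FractionRing R)
        (⟨D.a, D.a_mem_nonZeroDivisors⟩ : nonZeroDivisors R)
      have h2 : algebraMap R (FractionRing R) D.a * (↑v⁻¹ * algebraMap R _ z) =
          algebraMap R _ z := by
        change (v : FractionRing R) = algebraMap R _ D.a at hv
        rw [← hv, Units.mul_inv_cancel_left]
      refine ⟨s * (↑v⁻¹ * algebraMap R _ z), mul_mem hs (Algebra.subset_adjoin ⟨z, hz, h2⟩), ?_⟩
      rw [pow_succ, map_mul, map_mul, ← h1]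
      linear_combination algebraMap R (FractionRing R) (D.a ^ m) * s * h2
    · obtain ⟨s, hs, h1⟩ := hx
      obtain ⟨t, ht, h2⟩ := hy
      exact ⟨s + t, add_mem hs ht, by rw [mul_add, h1, h2, map_add]⟩

/-- Generators `i / a` of `S` carry `I ^ n` into `I ^ (n + 1) / a = I ^ n`. Applied to `a ^ n` this
gives `S ⊆ I ^ n / a ^ n`; the reverse inclusion is `exists_mem_S_of_mem_pow`. -/
theorem exists_mul_eq_of_mem_S (hn : D.I ^ (n + 1) = Ideal.span {D.a} * D.I ^ n)
    {s : FractionRing R} (hs : s ∈ D.S) :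
    ∀ x ∈ D.I ^ n, ∃ y ∈ D.I ^ n, s * algebraMap R _ x = algebraMap R (FractionRing R) y := by
  refine Algebra.adjoin_induction (fun s hs x hx => ?_) (fun r x hx => ?_)
    (fun s t _ _ hs ht x hx => ?_) (fun s t _ _ hs ht x hx => ?_) hs
  · obtain ⟨i, hi, h1⟩ := hs
    have h2 : x * i ∈ D.I ^ (n + 1) := by
      rw [pow_succ]
      exact Ideal.mul_mem_mul hx hi
    rw [hn] at h2
    obtain ⟨y, hy, h3⟩ := Ideal.mem_span_singleton_mul.mp h2
    refine ⟨y, hy, ?_⟩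
    refine (IsLocalization.map_units (FractionRing R)
      (⟨D.a, D.a_mem_nonZeroDivisors⟩ : nonZeroDivisors R)).mul_left_cancel ?_
    change algebraMap R (FractionRing R) D.a * _ = algebraMap R (FractionRing R) D.a * _
    rw [← mul_assoc, h1, ← map_mul, ← map_mul, h3, mul_comm]
  · exact ⟨r * x, Ideal.mul_mem_left _ r hx, (map_mul _ r x).symm⟩
  · obtain ⟨y, hy, h1⟩ := hs x hx
    obtain ⟨z, hz, h2⟩ := ht x hx
    exact ⟨y + z, Ideal.add_mem _ hy hz, by rw [add_mul, h1, h2, map_add]⟩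
  · obtain ⟨y, hy, h1⟩ := ht x hx
    obtain ⟨z, hz, h2⟩ := hs y hy
    exact ⟨z, hz, by rw [mul_assoc, h1, h2]⟩

theorem mem_conductor_iff (hn : D.I ^ (n + 1) = Ideal.span {D.a} * D.I ^ n) {r : R} :
    r ∈ D.conductor ↔ ∀ y ∈ D.I ^ n, r * y ∈ Ideal.span {D.a ^ n} := by
  have hmem : r ∈ D.conductor ↔ ∀ s ∈ D.S, ∃ w,
      algebraMap R (FractionRing R) w = algebraMap R (FractionRing R) r * s := by
    rw [conductor, Submodule.mem_comap, Submodule.mem_div_iff_forall_mul_mem]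
    simp only [Submodule.mem_one, Algebra.linearMap_apply, Subalgebra.mem_toSubmodule]
  have hinj := IsFractionRing.injective R (FractionRing R)
  rw [hmem]
  constructor
  · intro h y hy
    obtain ⟨s, hs, h1⟩ := D.exists_mem_S_of_mem_pow n hy
    obtain ⟨w, hw⟩ := h s hs
    refine Ideal.mem_span_singleton'.mpr ⟨w, hinj ?_⟩
    rw [map_mul, map_mul, hw, ← h1]
    ring
  · intro h s hs
    obtain ⟨y, hy, h1⟩ := D.exists_mul_eq_of_mem_S hn hs _ (Ideal.pow_mem_pow D.a_mem n)
    obtain ⟨w, hw⟩ := Ideal.mem_span_singleton'.mp (h y hy)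
    refine ⟨w, ?_⟩
    refine (IsLocalization.map_units (FractionRing R)
      (⟨D.a ^ n, pow_mem D.a_mem_nonZeroDivisors n⟩ : nonZeroDivisors R)).mul_right_cancel ?_
    change algebraMap R (FractionRing R) w * algebraMap R (FractionRing R) (D.a ^ n) =
      algebraMap R (FractionRing R) r * s * algebraMap R (FractionRing R) (D.a ^ n)
    rw [mul_assoc, h1, ← map_mul, ← map_mul, hw]

/-- This is `I : I = R`, obtained from duality for `F = (f)`. -/
theorem mem_span_singleton_of_mul_mem {f r : R} (hf : f ∈ nonZeroDivisors R)
    (h : ∀ y ∈ D.I, r * y ∈ Ideal.span {f} * D.I) : r ∈ Ideal.span {f} := by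
  by_contra hr
  obtain ⟨s, hs, hsr⟩ := D.isDualizing f hf _ (Ideal.mem_span_singleton_self f) r hr
  have h1 := hs f (Ideal.mem_span_singleton_self f)
  rw [mul_comm s f, mul_mem_span_singleton_mul_iff hf] at h1
  exact hsr (mul_comm r s ▸ h s h1)

theorem isCanonicalModule_span_mul (f : R) (hf : f ∈ nonZeroDivisors R) :
    IsCanonicalModule R ↥(Ideal.span {f} * D.I) := by
  have := D.isCohenMacaulay.isNoetherianRing
  let e : D.I ≃ₗ[R] ↥(Ideal.span {f} * D.I) := LinearEquiv.ofBijective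
    ((LinearMap.mulLeft R f ∘ₗ D.I.subtype).codRestrict _ fun x =>
      (mul_mem_span_singleton_mul_iff hf).mpr x.2)
    ⟨fun x y h => Subtype.ext ((mul_cancel_left_mem_nonZeroDivisors hf).mp
        (congrArg Subtype.val h)), fun ⟨y, hy⟩ => by
      obtain ⟨x, hx, rfl⟩ := Ideal.mem_span_singleton_mul.mp hy
      exact ⟨⟨x, hx⟩, rfl⟩⟩
  exact isCanonicalModule_of_hasTorsionFreeExtension (D.hasTorsionFreeExtension.of_linearEquiv e)
    (D.isCanonical.hasTypeOne.of_linearEquiv e) D.a_mem_maximalIdeal D.a_mem_nonZeroDivisors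
    (isSMulRegular_ideal D.a_mem_nonZeroDivisors _) inferInstance

variable (hn : D.I ^ (n + 1) = Ideal.span {D.a} * D.I ^ n)
include hn

theorem span_pow_le_conductor : Ideal.span {D.a ^ n} ≤ D.conductor := by
  rw [Ideal.span_singleton_le_iff_mem, D.mem_conductor_iff hn]
  exact fun y _ => Ideal.mul_mem_right _ _ (Ideal.mem_span_singleton_self _)

theorem span_pow_mul_le_conductor (J : Ideal R) : Ideal.span {D.a ^ n} * J ≤ D.conductor :=
  Ideal.mul_le_left.trans (D.span_pow_le_conductor hn)

theorem conductor_mul_pow_le {m : ℕ} :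
    D.conductor * D.I ^ (n + m) ≤ Ideal.span {D.a ^ (n + m)} := by
  rw [pow_add_eq_of_reduction hn]
  refine Ideal.mul_le.mpr fun x hx y hy => ?_
  obtain ⟨v, hv, rfl⟩ := Ideal.mem_span_singleton_mul.mp hy
  obtain ⟨w, hw⟩ := Ideal.mem_span_singleton'.mp ((D.mem_conductor_iff hn).mp hx v hv)
  exact Ideal.mem_span_singleton'.mpr ⟨w, by rw [pow_add]; linear_combination D.a ^ m * hw⟩

theorem conductor_mul_pow_le_mul_I {m : ℕ} :
    D.conductor * D.I ^ (n + (m + 1)) ≤ Ideal.span {D.a ^ (n + m)} * D.I := by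
  refine (D.conductor_mul_pow_le hn).trans ?_
  rw [Ideal.span_singleton_le_iff_mem, ← add_assoc, pow_succ]
  exact Ideal.mul_mem_mul (Ideal.mem_span_singleton_self _) D.a_mem

/-- The duality `K : 𝔠 = S`. -/
theorem mem_pow_of_conductor_mul_mem {i : R}
    (h : ∀ x ∈ D.conductor, x * i ∈ Ideal.span {D.a ^ n} * D.I) : i ∈ D.I ^ (n + 1) := by
  have ha := D.a_mem_nonZeroDivisors
  by_contra hi
  obtain ⟨s, hs, hsi⟩ := D.isDualizing (D.a ^ (n + 1)) (pow_mem ha _) _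
    (Ideal.pow_mem_pow D.a_mem (n + 1)) i hi
  -- Duality for `F = I ^ (n + 1)` gives `s` separating `i` from it. The inclusion `a ^ n I ⊆ F` and
  -- `I : I = R` force `s = x a`; the rest shows that `x` lies in the conductor, where `h`
  -- contradicts the choice of `s`.
  have h1 : s ∈ Ideal.span {D.a} := by
    refine D.mem_span_singleton_of_mul_mem ha fun y hy => ?_
    rw [← mul_mem_span_singleton_mul_iff (pow_mem ha n), ← mul_assoc,
      Ideal.span_singleton_mul_span_singleton, ← pow_succ]
    have h2 := hs (D.a ^ n * y) (by
      rw [pow_succ]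
      exact Ideal.mul_mem_mul (Ideal.pow_mem_pow D.a_mem n) hy)
    convert h2 using 1
    ring
  obtain ⟨x, rfl⟩ := Ideal.mem_span_singleton'.mp h1
  have h3 : ∀ g, x * D.a * g ∈ Ideal.span {D.a ^ (n + 1)} * D.I ↔
      x * g ∈ Ideal.span {D.a ^ n} * D.I := by
    intro g
    rw [← mul_mem_span_singleton_mul_iff ha (I := Ideal.span {D.a ^ n} * D.I), ← mul_assoc,
      Ideal.span_singleton_mul_span_singleton, ← pow_succ', mul_left_comm, mul_assoc]
  refine hsi ((h3 i).mpr (h x ((D.mem_conductor_iff hn).mpr fun y hy => ?_)))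
  refine D.mem_span_singleton_of_mul_mem (pow_mem ha n) fun y' hy' => ?_
  rw [mul_assoc, ← h3]
  refine hs _ ?_
  rw [pow_succ]
  exact Ideal.mul_mem_mul hy hy'

/-- The canonical ideal `aIⁿ × aⁿI` of the idealization. -/
def idealizationI : Ideal D.Idealization :=
  idealProd (D.I ^ (n + 1)) (Ideal.span {D.a ^ n} * D.I) (D.conductor_mul_pow_le_mul_I hn (m := 0))

/-- Evaluation at the second component realizes `Hom_R(R ⋉ 𝔠, K) = K × (K : 𝔠)`. A map on `𝔠` is
multiplication by a fraction determined at the regular element `a ^ n ∈ 𝔠`, and that fraction lies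
in `K : 𝔠 = S`. -/
theorem isCanonicalModule_idealizationI : IsCanonicalModule D.Idealization (D.idealizationI hn) := by
  have := D.isCohenMacaulay.isNoetherianRing
  have ha := pow_mem D.a_mem_nonZeroDivisors n
  have hreg := inl_mem_nonZeroDivisors (c := D.conductor) D.a_mem_nonZeroDivisors
  have hmem : ∀ z : D.idealizationI hn,
      ((z : D.Idealization).snd : R) ∈ Ideal.span {D.a ^ n} * D.I := fun z => z.2.2
  let φ : D.idealizationI hn →ₗ[R] ↥(Ideal.span {D.a ^ n} * D.I) :=
    (D.conductor.subtype ∘ₗ sndHom R D.conductor ∘ₗ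
      (D.idealizationI hn).subtype.restrictScalars R).codRestrict _ hmem
  have hφ : ∀ (w : D.Idealization) (z : D.idealizationI hn), ((φ (w • z) : _) : R) =
      w.fst * (z : D.Idealization).snd + (z : D.Idealization).fst * w.snd :=
    fun w z => coe_snd_mul w z
  have hα : D.a ^ n ∈ D.conductor :=
    D.span_pow_le_conductor hn (Ideal.mem_span_singleton_self _)
  refine IsCanonicalModule.coinduced D.isCohenMacaulay
    (D.isCanonicalModule_span_mul (D.a ^ n) ha) (fstHom R R D.conductor) φ
    (fun z hz => ?_) (fun g => ?_) D.a_mem_maximalIdeal hreg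
    (isSMulRegular_ideal hreg _) inferInstance
  · have h1 := congrArg Subtype.val (hz 1)
    have h2 := congrArg Subtype.val (hz (inr ⟨D.a ^ n, hα⟩))
    rw [hφ] at h1 h2
    simp only [fst_one, snd_one, ZeroMemClass.coe_zero, mul_zero, add_zero, one_mul, fst_inr,
      snd_inr, zero_mul, zero_add] at h1 h2
    exact Subtype.ext (TrivSqZeroExt.ext
      ((mul_right_mem_nonZeroDivisors_eq_zero_iff ha).mp h2) (Subtype.ext h1))
  · obtain ⟨i, hi, hgi⟩ := Ideal.mem_span_singleton_mul.mp (g (inr ⟨D.a ^ n, hα⟩)).2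
    have h1 : ∀ x : D.conductor, (g (inr x) : R) = x * i := by
      intro x
      have h2 : D.a ^ n • g (inr x) = (x : R) • g (inr ⟨D.a ^ n, hα⟩) := by
        rw [← map_smul, ← map_smul, ← inr_smul, ← inr_smul]
        congr 2
        ext
        exact mul_comm _ _
      have h3 := congrArg Subtype.val h2
      change D.a ^ n * (g (inr x) : R) = x * (g (inr ⟨D.a ^ n, hα⟩) : R) at h3
      refine (mul_cancel_left_mem_nonZeroDivisors ha).mp ?_
      rw [h3, ← hgi]
      ring
    have hi' : i ∈ D.I ^ (n + 1) := D.mem_pow_of_conductor_mul_mem hn fun x hx => by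
      rw [← h1 ⟨x, hx⟩]
      exact (g _).2
    have hq := (g 1).2
    refine ⟨⟨inl i + inr ⟨g 1, D.span_pow_mul_le_conductor hn _ hq⟩, ?_, ?_⟩, fun w => ?_⟩
    · simpa using hi'
    · simp
    · ext
      rw [hφ]
      have h4 : w = w.fst • (1 : D.Idealization) + inr w.snd := by
        rw [← inl_mul_eq_smul, mul_one, inl_fst_add_inr_snd_eq]
      conv_rhs => rw [h4, map_add, map_smul]
      change _ = w.fst * (g 1 : R) + (g (inr w.snd) : R)
      rw [h1]
      simp [mul_comm]

/-- This is `(S × K)² = S × S K = S × S`, scaled by `a ^ (2n + 2)`. -/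
theorem idealizationI_sq (h2 : D.conductor * D.I ^ (2 * n + 2) ≤ D.I ^ (2 * n + 2)) :
    D.idealizationI hn ^ 2 = idealProd (D.I ^ (2 * n + 2)) (D.I ^ (2 * n + 2)) h2 := by
  have hc := D.span_pow_mul_le_conductor hn D.I
  rw [sq]
  refine idealProd_mul_idealProd hc hc ?_ ?_
  · rw [← pow_add]
    congr 1
    ring
  · rw [sup_idem, mul_left_comm, ← pow_succ, show n + 1 + 1 = n + 2 from rfl,
      pow_add_eq_of_reduction hn 2, mul_left_comm, ← pow_add_eq_of_reduction hn n,
      ← pow_add_eq_of_reduction (pow_succ_eq_of_reduction hn (Nat.le_add_right n n))]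
    congr 1
    ring

theorem pow_le_conductor {m : ℕ} (hm : 2 * n ≤ m) : D.I ^ m ≤ D.conductor := by
  refine (Ideal.pow_le_pow_right hm).trans ?_
  rw [two_mul, pow_add_eq_of_reduction hn]
  exact D.span_pow_mul_le_conductor hn _

theorem idealizationI_cube :
    D.idealizationI hn ^ 3 =
      Ideal.span {(inl (D.a ^ (n + 1)) : D.Idealization)} * D.idealizationI hn ^ 2 := by
  have h2 : D.conductor * D.I ^ (2 * n + 2) ≤ D.I ^ (2 * n + 2) := Ideal.mul_le_right
  have h3 : D.conductor * D.I ^ (3 * n + 3) ≤ D.I ^ (3 * n + 3) := Ideal.mul_le_right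
  have hc := D.span_pow_mul_le_conductor hn D.I
  have hc2 : D.I ^ (2 * n + 2) ≤ D.conductor := D.pow_le_conductor hn (by omega)
  have key : ∀ m j k, n ≤ m → m + j = k → Ideal.span {D.a ^ j} * D.I ^ m = D.I ^ k := by
    rintro m j k hm rfl
    exact (pow_add_eq_of_reduction (pow_succ_eq_of_reduction hn hm) j).symm
  have h4 : Ideal.span {D.a ^ (n + 1)} * D.I ^ (2 * n + 2) = D.I ^ (3 * n + 3) :=
    key _ _ _ (by omega) (by omega)
  rw [pow_succ, idealizationI_sq D hn h2,
    span_inl_mul_idealProd (h₂ := h3) hc2 h4.symm h4.symm]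
  refine idealProd_mul_idealProd hc2 hc ?_ ?_
  · rw [← pow_add]
    congr 1
    ring
  · rw [mul_left_comm, ← pow_succ, key _ _ (3 * n + 3) (by omega) (by omega), ← pow_add,
      show n + 1 + (2 * n + 2) = 3 * n + 3 by ring, sup_idem]

/-- The standing data for the idealization `R ⋉ 𝔠`. -/
def idealization : CanonicalSetting D.Idealization where
  isCohenMacaulay := D.isCohenMacaulay.trivSqZeroExt
  I := D.idealizationI hn
  I_ne_top h := by
    have h1 := ((Ideal.eq_top_iff_one _).mp h).1
    rw [fst_one, ← Ideal.eq_top_iff_one] at h1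
    exact D.I_ne_top (top_le_iff.mp (h1.ge.trans (Ideal.pow_le_self n.succ_ne_zero)))
  isCanonical := D.isCanonicalModule_idealizationI hn
  a := inl (D.a ^ (n + 1))
  isParameter := by
    apply le_antisymm
    · rw [(maximalIdeal.isMaximal _).isPrime.radical_le_iff, Ideal.span_singleton_le_iff_mem,
        mem_maximalIdeal_trivSqZeroExt]
      exact Ideal.pow_mem_of_mem _ D.a_mem_maximalIdeal _ n.succ_pos
    · intro z hz
      rw [← inl_fst_add_inr_snd_eq z]
      refine Ideal.add_mem _ ?_ ⟨2, ?_⟩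
      · have h1 := mem_maximalIdeal_trivSqZeroExt.mp hz
        rw [← D.isParameter] at h1
        obtain ⟨k, hk⟩ := h1
        obtain ⟨w, hw⟩ := Ideal.mem_span_singleton'.mp hk
        refine ⟨k * (n + 1), Ideal.mem_span_singleton'.mpr ⟨inl (w ^ (n + 1)), ?_⟩⟩
        rw [inl_mul_inl, ← mul_pow, hw, ← pow_mul]
        exact map_pow (inlHom R D.conductor) _ _
      · rw [sq, inr_mul_inr]
        exact Ideal.zero_mem _
  a_mem := ⟨Ideal.pow_mem_pow D.a_mem _, Ideal.zero_mem _⟩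
  isReduction := ⟨2, D.idealizationI_cube hn⟩

theorem sallyRank_idealization : (D.idealization hn).sallyRank = D.sallyRank := by
  -- Over `R ⋉ 𝔠` the exponent is one, as the square of the canonical ideal is already stable. Over
  -- `R` the exponent `2n + 1` is chosen so that `S / K` appears with the same scaling, as `I ^ (2n
  -- + 2) / a ^ (2n + 1) I`.
  have hR : D.I ^ (2 * n + 1 + 2) = Ideal.span {D.a} * D.I ^ (2 * n + 1 + 1) :=
    pow_succ_eq_of_reduction hn (by omega)
  rw [(D.idealization hn).sallyRank_eq_relLength (n := 1) (D.idealizationI_cube hn),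
    D.sallyRank_eq_relLength hR]
  have h2 : D.conductor * D.I ^ (2 * n + 2) ≤ D.I ^ (2 * n + 2) := Ideal.mul_le_right
  have h1 : D.conductor * D.I ^ (2 * n + 2) ≤ Ideal.span {D.a ^ (2 * n + 1)} * D.I := by
    have := D.conductor_mul_pow_le_mul_I hn (m := n + 1)
    rwa [show n + (n + 1 + 1) = 2 * n + 2 by ring, show n + (n + 1) = 2 * n + 1 by ring] at this
  have hc := D.span_pow_mul_le_conductor hn D.I
  have hJ2 : (D.idealization hn).I ^ (1 + 1) =
      idealProd (D.I ^ (2 * n + 2)) (D.I ^ (2 * n + 2)) h2 := D.idealizationI_sq hn h2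
  have hbJ : Ideal.span {(D.idealization hn).a ^ 1} * (D.idealization hn).I =
      idealProd (D.I ^ (2 * n + 2)) (Ideal.span {D.a ^ (2 * n + 1)} * D.I) h1 := by
    rw [pow_one]
    refine span_inl_mul_idealProd (h := D.conductor_mul_pow_le_mul_I hn (m := 0)) hc ?_ ?_
    · rw [← pow_add_eq_of_reduction (pow_succ_eq_of_reduction hn n.le_succ)]
      congr 1
      omega
    · rw [← mul_assoc, Ideal.span_singleton_mul_span_singleton, ← pow_add]
      congr 4
      ring
  rw [hJ2, hbJ]
  exact relLength_idealProd (D.pow_le_conductor hn (by omega))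

end CanonicalSetting

/-! ### Embedding dimension, nilpotents and the tower. -/

section Tower

open IsLocalRing TrivSqZeroExt

/-- Take `x ∈ c` outside `𝔪c` and write `inr x` in minimal generators of the maximal ideal of `R ⋉
c`. Some coefficient is a unit, otherwise `x ∈ 𝔪c`. First components then give a relation making one
generator redundant for `𝔪`. -/
theorem spanFinrank_maximalIdeal_lt_trivSqZeroExt {R : Type u} [CommRing R] [IsLocalRing R]
    [IsNoetherianRing R] {c : Ideal R} (hc : c ≠ ⊥) :
    (maximalIdeal R).spanFinrank < (maximalIdeal (TrivSqZeroExt R c)).spanFinrank := by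
  classical
  have hm : ¬ c ≤ maximalIdeal R * c := fun h => hc
    (Submodule.eq_bot_of_le_smul_of_le_jacobson_bot _ _ (IsNoetherian.noetherian c) h
      (maximalIdeal_le_jacobson _))
  obtain ⟨x, hx, hxm⟩ := SetLike.not_le_iff_exists.mp hm
  obtain ⟨s, hs, hspan⟩ := (IsNoetherian.noetherian
    (maximalIdeal (TrivSqZeroExt R c))).exists_span_finset_card_eq_spanFinrank
  have hsm : ∀ z ∈ s, z ∈ maximalIdeal (TrivSqZeroExt R c) := fun z hz =>
    hspan ▸ Submodule.subset_span hz
  have hxA : (inr ⟨x, hx⟩ : TrivSqZeroExt R c) ∈ maximalIdeal (TrivSqZeroExt R c) :=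
    mem_maximalIdeal_trivSqZeroExt.mpr (Ideal.zero_mem _)
  rw [← hspan] at hxA
  obtain ⟨f, -, hf⟩ := Submodule.mem_span_finset.mp hxA
  have hunit : ∃ z ∈ s, IsUnit (f z).fst := by
    by_contra! h
    have h1 : (inr ⟨x, hx⟩ : TrivSqZeroExt R c) ∈
        idealProd (maximalIdeal R) (maximalIdeal R * c) (mul_comm c _).le := by
      rw [← hf]
      refine Ideal.sum_mem _ fun z hz => ⟨?_, ?_⟩
      · rw [smul_eq_mul, fst_mul]
        exact Ideal.mul_mem_right _ _ (h z hz)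
      · rw [smul_eq_mul, coe_snd_mul]
        exact Ideal.add_mem _ (Ideal.mul_mem_mul (h z hz) z.snd.2)
          (Ideal.mul_mem_mul (mem_maximalIdeal_trivSqZeroExt.mp (hsm z hz)) (f z).snd.2)
    exact hxm h1.2
  obtain ⟨z, hz, hu⟩ := hunit
  let N := Ideal.span (fstHom R R c '' (s.erase z : Finset _))
  have hN : ∀ w ∈ s.erase z, w.fst ∈ N := fun w hw => Ideal.subset_span ⟨w, hw, rfl⟩
  have hzN : z.fst ∈ N := by
    rw [← Finset.add_sum_erase _ _ hz] at hf
    have h1 := congrArg (fstHom R R c) hf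
    rw [map_add, map_sum] at h1
    have h2 : (f z).fst * z.fst = - ∑ w ∈ s.erase z, (f w).fst * w.fst :=
      eq_neg_of_add_eq_zero_left h1
    rw [← Ideal.unit_mul_mem_iff_mem N hu, h2]
    exact N.neg_mem (N.sum_mem fun w hw => N.mul_mem_left _ (hN w hw))
  have hle : maximalIdeal (TrivSqZeroExt R c) ≤ N.comap (fstHom R R c) := by
    rw [← hspan, Submodule.span_le]
    intro w hw
    by_cases h : w = z
    · exact h ▸ hzN
    · exact hN w (Finset.mem_erase.mpr ⟨h, hw⟩)
  have hNm : maximalIdeal R = N := by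
    apply le_antisymm
    · exact fun r hr => hle (show inl r ∈ _ from mem_maximalIdeal_trivSqZeroExt.mpr hr)
    · refine Ideal.span_le.mpr ?_
      rintro _ ⟨w, hw, rfl⟩
      exact mem_maximalIdeal_trivSqZeroExt.mp (hsm w (Finset.mem_of_mem_erase hw))
  have hfin := (s.erase z).finite_toSet
  calc (maximalIdeal R).spanFinrank = N.spanFinrank := by rw [hNm]
    _ ≤ (fstHom R R c '' (s.erase z : Finset _)).ncard :=
      Submodule.spanFinrank_span_le_ncard_of_finite (hfin.image _)
    _ ≤ (s.erase z).card := by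
      rw [← Set.ncard_coe_finset]
      exact Set.ncard_image_le hfin
    _ < s.card := Finset.card_erase_lt_of_mem hz
    _ = _ := hs

/-- A Noetherian local ring embeds in its completion, so a nonzero nilpotent stays nonzero there. -/
theorem isAnalyticallyRamified_of_isNilpotent {A : Type u} [CommRing A] [IsLocalRing A]
    [IsNoetherianRing A] {x : A} (hx : x ≠ 0) (hn : IsNilpotent x) : IsAnalyticallyRamified A := by
  intro h
  have h1 := (hn.map (algebraMap A (AdicCompletion (maximalIdeal A) A))).eq_zero
  exact hx (AdicCompletion.of_injective (maximalIdeal A) A (h1.trans (map_zero _).symm))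

theorem RingEquiv.spanFinrank_maximalIdeal_eq {A B : Type u} [CommRing A] [CommRing B]
    [IsLocalRing A] [IsLocalRing B] (e : A ≃+* B) :
    (maximalIdeal A).spanFinrank = (maximalIdeal B).spanFinrank := by
  rw [← Ideal.spanFinrank_map_eq_of_ringEquiv e]
  congr 1
  ext y
  obtain ⟨x, rfl⟩ := e.surjective y
  exact e.map_mem_map_iff.trans e.map_mem_maximalIdeal_iff.symm

end Tower

namespace CanonicalSetting

open TrivSqZeroExt

variable {R : Type u} [CommRing R] [IsLocalRing R] (D : CanonicalSetting R)

theorem exists_ne_zero_mem_conductor : ∃ x ∈ D.conductor, x ≠ 0 := by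
  obtain ⟨n, hn⟩ := D.isReduction
  exact ⟨D.a ^ n, D.span_pow_le_conductor hn (Ideal.mem_span_singleton_self _),
    nonZeroDivisors.ne_zero (pow_mem D.a_mem_nonZeroDivisors n)⟩

theorem isTwoAGL_idealization_iff : IsTwoAGL D.Idealization ↔ IsTwoAGL R := by
  obtain ⟨n, hn⟩ := D.isReduction
  rw [(D.idealization hn).isTwoAGL_iff, D.sallyRank_idealization hn, D.isTwoAGL_iff]

theorem isAnalyticallyRamified_of_ringEquiv {A : Type u} [CommRing A] [IsLocalRing A]
    (e : A ≃+* D.Idealization) : IsAnalyticallyRamified A := by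
  have := D.isCohenMacaulay.isNoetherianRing
  have : IsNoetherianRing A := isNoetherianRing_of_ringEquiv _ e.symm
  obtain ⟨x, hx, hx0⟩ := D.exists_ne_zero_mem_conductor
  have h0 : (inr ⟨x, hx⟩ : D.Idealization) ≠ 0 := fun h =>
    hx0 (congrArg (fun z : D.Idealization => (z.snd : R)) h)
  refine isAnalyticallyRamified_of_isNilpotent (x := e.symm (inr ⟨x, hx⟩)) (by simpa using h0) ?_
  exact IsNilpotent.map ⟨2, by rw [sq, inr_mul_inr]⟩ e.symm

theorem spanFinrank_maximalIdeal_lt_idealization :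
    (IsLocalRing.maximalIdeal R).spanFinrank <
      (IsLocalRing.maximalIdeal D.Idealization).spanFinrank := by
  have := D.isCohenMacaulay.isNoetherianRing
  obtain ⟨x, hx, hx0⟩ := D.exists_ne_zero_mem_conductor
  exact spanFinrank_maximalIdeal_lt_trivSqZeroExt fun h => hx0 (by simpa [h] using hx)

theorem exists_isConductorTower {R : Type u} [CommRing R] [IsLocalRing R]
    (D : CanonicalSetting R) : ∃ (A : ℕ → Type u) (_ : ∀ n, CommRing (A n))
      (_ : ∀ n, IsLocalRing (A n)), IsConductorTower R A := by
  -- The recursion carries a canonical datum with each ring, since the next ring is built from the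
  -- conductor of that datum.
  let T := Σ' (B : Type u) (_ : CommRing B) (_ : IsLocalRing B), CanonicalSetting B
  let (t : T) : CommRing t.1 := t.2.1
  let (t : T) : IsLocalRing t.1 := t.2.2.1
  let next : T → T := fun t => ⟨t.2.2.2.Idealization, inferInstance, inferInstance,
    t.2.2.2.idealization t.2.2.2.isReduction.choose_spec⟩
  let X : ℕ → T := Nat.rec ⟨R, inferInstance, inferInstance, D⟩ fun _ => next
  exact ⟨fun n => (X n).1, fun n => (X n).2.1, fun n => (X n).2.2.1, ⟨RingEquiv.refl R⟩,
    fun n => ⟨(X n).2.2.2, ⟨RingEquiv.refl (X n).2.2.2.Idealization⟩⟩⟩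

end CanonicalSetting

section Tower

variable {R : Type u} [CommRing R] {A : ℕ → Type u} [∀ n, CommRing (A n)] [∀ n, IsLocalRing (A n)]

theorem IsConductorTower.isTwoAGL [IsLocalRing R] (h : IsConductorTower R A) (hR : IsTwoAGL R) (n : ℕ) :
    IsTwoAGL (A n) := by
  induction n with
  | zero => exact hR.of_ringEquiv h.1.some.symm
  | succ n ih =>
    obtain ⟨D, ⟨e⟩⟩ := h.2 n
    exact (D.isTwoAGL_idealization_iff.mpr ih).of_ringEquiv e.symm

theorem IsConductorTower.isAnalyticallyRamified (h : IsConductorTower R A) {n : ℕ} (hn : 1 ≤ n) :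
    IsAnalyticallyRamified (A n) := by
  obtain ⟨n, rfl⟩ := Nat.exists_eq_succ_of_ne_zero (Nat.one_le_iff_ne_zero.mp hn)
  obtain ⟨D, ⟨e⟩⟩ := h.2 n
  exact D.isAnalyticallyRamified_of_ringEquiv e

theorem IsConductorTower.isEmpty_ringEquiv (h : IsConductorTower R A) {m n : ℕ} (hmn : m ≠ n) :
    IsEmpty (A m ≃+* A n) := by
  have hmono : StrictMono fun n => (IsLocalRing.maximalIdeal (A n)).spanFinrank :=
    strictMono_nat_of_lt_succ fun n => by
      obtain ⟨D, ⟨e⟩⟩ := h.2 n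
      rw [e.spanFinrank_maximalIdeal_eq]
      exact D.spanFinrank_maximalIdeal_lt_idealization
  exact ⟨fun e => hmn (hmono.injective e.spanFinrank_maximalIdeal_eq)⟩

end Tower

theorem theorem4p2 {R : Type u} [CommRing R] [IsLocalRing R] (D : CanonicalSetting R) :
    Nonempty (CanonicalSetting D.Idealization) ∧
    (IsTwoAGL D.Idealization ↔ IsTwoAGL R) ∧
    (IsTwoAGL R →
      (∃ (A : ℕ → Type u) (_ : ∀ n, CommRing (A n)) (_ : ∀ n, IsLocalRing (A n)),
        IsConductorTower R A) ∧
      ∀ (A : ℕ → Type u) [∀ n, CommRing (A n)] [∀ n, IsLocalRing (A n)],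
        IsConductorTower R A →
          (∀ n, IsTwoAGL (A n)) ∧
          (∀ n, 1 ≤ n → IsAnalyticallyRamified (A n)) ∧
          (∀ m n, m ≠ n → IsEmpty (A m ≃+* A n))) := by
  obtain ⟨n, hn⟩ := D.isReduction
  exact ⟨⟨D.idealization hn⟩, D.isTwoAGL_idealization_iff, fun hR => ⟨D.exists_isConductorTower,
    fun A _ _ h => ⟨h.isTwoAGL hR, fun _ => h.isAnalyticallyRamified,
      fun _ _ => h.isEmpty_ringEquiv⟩⟩⟩
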